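/- Let $\mathbb F_q$ be a finite field with $q$ elements and let $n\ge 2$. Grade $\mathbb F_q[x_1,\ldots,x_n]$ by giving every variable degree one. Let $\mathcal P$ be the Steenrod algebra over $\mathbb F_q$, i.e. the $\mathbb F_q$-algebra of operations on polynomial algebras generated by the reduced Steenrod operations $P^k$ ($k\ge 0$), which are the $\mathbb F_q$-linear maps determined by $$P^k(x^m)=\binom{m}{k}x^{m+(q-1)k}\ \text{ for every linear form } x \text{ and } m\ge 0,\qquad P^k(fg)=\sum_{i+j=k}P^i(f)P^j(g).$$ Let $\mathcal P^+$ be the augmentation ideal of $\mathcal P$, and for a $\mathcal P$-module $M$ put $Q(M)=M/\mathcal P^+M$. Let $Q^d(\mathbb F_q[x_1,\ldots,x_n])$ denote the component of degree $d$ of the graded vector space $Q(\mathbb F_q[x_1,\ldots,x_n])$. Then $$\dim_{\mathbb F_q}Q^{\,q^{n-1}-n}(\mathbb F_q[x_1,\ldots,x_n])=(q-1)(q^2-1)\cdots(q^{n-1}-1).$$ -/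

import Mathlib

open scoped BigOperators

noncomputable section

namespace HitProblem

variable (F : Type*) [Field F] [Fintype F]

/-- The polynomial algebra `F[x_1, …, x_n]`, every variable having degree one. -/
abbrev Poly (n : ℕ) : Type _ := MvPolynomial (Fin n) F

/-- The total Steenrod operation with a formal parameter `ξ`: the homomorphism of `F`-algebras
`F[x_1, …, x_n] → F[x_1, …, x_n][ξ]` with `x_i ↦ x_i + x_i ^ q ξ`, where `q = |F|`.
As `x ↦ x ^ q` is `F`-linear, every linear form `x` is sent to `x + x ^ q ξ`. -/
def totalOperation (n : ℕ) : Poly F n →ₐ[F] Polynomial (Poly F n) :=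
  MvPolynomial.aeval fun i =>
    Polynomial.C (MvPolynomial.X i) +
      Polynomial.C (MvPolynomial.X i ^ Fintype.card F) * Polynomial.X

/-- The reduced Steenrod operation `P^k` on `F[x_1, …, x_n]`: the coefficient of `ξ ^ k` in the
total operation. Multiplicativity of the total operation is the Cartan formula, and
`P^k (x ^ m) = (m choose k) x ^ (m + (q - 1) k)` for every linear form `x`. -/
def reducedPower (k n : ℕ) : Module.End F (Poly F n) :=
  ((Polynomial.lcoeff (Poly F n) k).restrictScalars F) ∘ₗ (totalOperation F n).toLinearMap

/-- The Steenrod algebra: the `F`-algebra of operations on polynomial algebras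
(families of `F`-linear endomorphisms of `F[x_1, …, x_m]`, one for every number `m` of variables)
generated by the reduced Steenrod operations `P^k = (P^k on F[x_1, …, x_m])_m`, `k ≥ 0`. -/
def steenrodSubalgebra : Subalgebra F (∀ m : ℕ, Module.End F (Poly F m)) :=
  Algebra.adjoin F (Set.range fun k m => reducedPower F k m)

/-- The Steenrod algebra over `F`, as a type. -/
def Steenrod : Type _ := steenrodSubalgebra F

instance : Ring (Steenrod F) :=
  inferInstanceAs (Ring (steenrodSubalgebra F))

instance : Algebra F (Steenrod F) :=
  inferInstanceAs (Algebra F (steenrodSubalgebra F))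

/-- The inclusion of the Steenrod algebra into all families of endomorphisms. -/
def steenrodVal : Steenrod F →ₐ[F] (∀ m : ℕ, Module.End F (Poly F m)) :=
  (steenrodSubalgebra F).val

/-- The Steenrod algebra acts on `F[x_1, …, x_n]` through its `n`-th component. -/
instance steenrodModule (n : ℕ) : Module (Steenrod F) (Poly F n) :=
  Module.compHom (Poly F n)
    ((Pi.evalRingHom (fun m : ℕ => Module.End F (Poly F m)) n).comp
      (steenrodVal F).toRingHom)

theorem steenrod_smul_def (n : ℕ) (θ : Steenrod F) (f : Poly F n) : θ • f = steenrodVal F θ n f := rfl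

instance steenrodScalarTower (n : ℕ) : IsScalarTower F (Steenrod F) (Poly F n) where
  smul_assoc _ _ _ := rfl

/-- The augmentation `ε` of the Steenrod algebra: `ε θ` is the scalar by which `θ` acts on the
polynomial algebra `F` in no variables. Thus `ε (P^0) = 1`, and `ε (P^k) = 0` for `k ≥ 1`. -/
def augmentation : Steenrod F →ₐ[F] F :=
  AlgHom.ofLinearMap
    { toFun := fun θ => MvPolynomial.constantCoeff (θ • (1 : Poly F 0))
      map_add' := fun a b => by rw [add_smul, map_add]
      map_smul' := fun c a => by
        rw [smul_assoc, MvPolynomial.smul_eq_C_mul, map_mul, MvPolynomial.constantCoeff_C]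
        rfl }
    (by simp)
    (fun a b => by
      have h : ∀ (θ : Steenrod F) (f : Poly F 0), MvPolynomial.constantCoeff (θ • f) =
          MvPolynomial.constantCoeff (θ • (1 : Poly F 0)) * MvPolynomial.constantCoeff f := by
        intro θ f
        have hf : f = MvPolynomial.constantCoeff f • (1 : Poly F 0) := by
          rw [MvPolynomial.smul_eq_C_mul, mul_one]
          exact MvPolynomial.eq_C_of_isEmpty f
        conv_lhs => rw [hf, steenrod_smul_def, map_smul, MvPolynomial.smul_eq_C_mul, map_mul,
          MvPolynomial.constantCoeff_C, mul_comm]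
        rfl
      change MvPolynomial.constantCoeff ((a * b) • (1 : Poly F 0)) = _
      rw [mul_smul, h]
      rfl)

/-- The augmentation ideal `P⁺` of the Steenrod algebra. -/
def augmentationIdeal : Ideal (Steenrod F) := RingHom.ker (augmentation F)

/-- The submodule `P⁺ M` of a module `M` over the Steenrod algebra, spanned by all
`θ m` with `θ ∈ P⁺` and `m ∈ M`. -/
def hit (M : Type*) [AddCommGroup M] [Module (Steenrod F) M] : Submodule (Steenrod F) M :=
  Submodule.span (Steenrod F) {x | ∃ θ ∈ augmentationIdeal F, ∃ m : M, x = θ • m}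

/-- The module `Q(M) = M / P⁺ M` of indecomposable elements of `M`. -/
abbrev Indecomposables (M : Type*) [AddCommGroup M] [Module (Steenrod F) M] : Type _ :=
  M ⧸ hit F M

/-- The component `Q^d (F[x_1, …, x_n])` of degree `d` of the graded `F`-vector space
`Q (F[x_1, …, x_n])`, i.e. the image of the space of homogeneous polynomials of degree `d`. -/
def indecomposablesDegree (n d : ℕ) : Submodule F (Indecomposables F (Poly F n)) :=
  (MvPolynomial.homogeneousSubmodule (Fin n) F d).map
    ((hit F (Poly F n)).mkQ.restrictScalars F)

end HitProblem

end

/-! The proof is an induction on the number of variables. Put A = q^K - (K+1), d = q^(K+1) - (K+2)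
and N = K+1. The passage from N variables in degree A to N+1 variables in degree d multiplies the
dimension by q^N - 1 (`finrank_cohits_succ`).

Name the variables z, x_1, ..., x_N. Let V_j = x_j^q - z^(q-1) x_j and let I be the ideal generated
by the V_j; these forms vanish at the rational points (1, c). One has d = qA + δ with δ = N(q-1) -
1. Filter the forms of degree d by powers of I. Modulo hit elements only the layer I^A / I^(A+1)
matters. Below A, the leading term of P^t (h(V) φ) is a multiple of h(V) z^((q-1)t) φ by a binomial
coefficient, and for t a suitable power of p that coefficient is a unit; so elements can be pushed
up (`exists_sub_reducedPower_mem`). Above A, everything is hit, by an argument with the inverse of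
the total operation and a count of exponents (`mem_hitSubspace_of_mem_pointIdeal_pow`). The layer
itself is spanned by products h(V) μ, where h has degree A and μ is a monomial of degree δ reduced
in the x_j. Every reduced exponent vector except (q-1, ..., q-1) occurs, which gives the factor q^N
- 1.

It remains to see that h(V) μ is hit when h is hit (`aeval_orbitForm_reducedPower_mul_mem`), and
that there are no other relations (`homogeneousComponent_translation_mem`). Both use expansions at
the points (1, c). The substitution x ↦ (1-ξ)x + ξ x^q fixes rational points, so the operations act
on local expansions (`homogeneousComponent_reducedPower`). For a P^k with k > 0 landing in degree d,
the contribution to the component of degree A that involves no operation has a coefficient divisible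
by p (`dvd_choose_of_lt`). Hence these components of hit elements are again hit. At (1, c) the
lowest term of h(V) μ is ± μ(1, c) h, and the reduced monomials are linearly independent as
functions of c. -/

set_option linter.unusedSectionVars false

noncomputable section

namespace HitProblem

open MvPolynomial

/-! ### Formal properties of the reduced powers. -/

section ReducedPowers

variable {F : Type*} [Field F] {n : ℕ}

/-- Induction on homogeneous polynomials, by multiplication with variables. -/
theorem homogeneous_induction {motive : ℕ → Poly F n → Prop}
    (zero : ∀ D, motive D 0)
    (add : ∀ D f g, motive D f → motive D g → motive D (f + g))
    (const : ∀ c, motive 0 (C c))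
    (X_mul : ∀ D i f, f.IsHomogeneous D → motive D f → motive (D + 1) (X i * f))
    {D : ℕ} {f : Poly F n} (hf : f.IsHomogeneous D) : motive D f := by
  have key : ∀ D (s : Fin n →₀ ℕ) (c : F), s.degree = D → motive D (monomial s c) := by
    intro D
    induction D with
    | zero =>
      intro s c hs
      have : s = 0 := (Finsupp.degree_eq_zero_iff s).1 hs
      subst this
      exact const c
    | succ D ih =>
      intro s c hs
      obtain ⟨i, hi⟩ : ∃ i, s i ≠ 0 := by
        by_contra! h
        have : s = 0 := Finsupp.ext h
        simp [this] at hs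
      have hsi : Finsupp.single i 1 + (s - Finsupp.single i 1) = s := by
        rw [add_comm]
        refine tsub_add_cancel_of_le ?_
        rw [Finsupp.single_le_iff]
        omega
      have hdeg : (s - Finsupp.single i 1).degree = D := by
        have := congrArg Finsupp.degree hsi
        simp only [map_add, Finsupp.degree_single] at this
        omega
      have : monomial s c = X i * monomial (s - Finsupp.single i 1) c := by
        rw [X, monomial_mul, hsi, one_mul]
      rw [this]
      exact X_mul D i _ (isHomogeneous_monomial c hdeg) (ih _ c hdeg)
  rw [f.as_sum]
  have : ∀ t ⊆ f.support, motive D (∑ v ∈ t, monomial v (coeff v f)) := by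
    intro t
    induction t using Finset.induction_on with
    | empty => intro _; simpa using zero D
    | insert a t ha ih =>
      intro h
      rw [Finset.sum_insert ha]
      refine add D _ _ (key D a _ ?_) (ih fun x hx => h (Finset.mem_insert_of_mem hx))
      by_contra hne
      exact (mem_support_iff.1 (h (Finset.mem_insert_self a t))) (hf.coeff_eq_zero hne)
  exact this _ subset_rfl

variable [Fintype F]

theorem reducedPower_apply (k : ℕ) (f : Poly F n) :
    reducedPower F k n f = (totalOperation F n f).coeff k := rfl

theorem totalOperation_X (i : Fin n) :
    totalOperation F n (X i) =
      Polynomial.C (X i) + Polynomial.C (X i ^ Fintype.card F) * Polynomial.X := by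
  simp [totalOperation]

theorem reducedPower_C (k : ℕ) (c : F) :
    reducedPower F k n (C c) = if k = 0 then C c else 0 := by
  rw [reducedPower_apply, ← MvPolynomial.algebraMap_eq, AlgHom.commutes,
    IsScalarTower.algebraMap_apply F (Poly F n) (Polynomial (Poly F n)),
    Polynomial.algebraMap_apply, Polynomial.coeff_C]
  rfl

theorem reducedPower_zero_X_mul (i : Fin n) (f : Poly F n) :
    reducedPower F 0 n (X i * f) = X i * reducedPower F 0 n f := by
  simp [reducedPower_apply, totalOperation_X, add_mul, mul_assoc]

theorem reducedPower_succ_X_mul (k : ℕ) (i : Fin n) (f : Poly F n) :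
    reducedPower F (k + 1) n (X i * f) =
      X i * reducedPower F (k + 1) n f + X i ^ Fintype.card F * reducedPower F k n f := by
  rw [reducedPower_apply, map_mul, totalOperation_X, add_mul, Polynomial.coeff_add, mul_assoc,
    Polynomial.coeff_C_mul, Polynomial.coeff_C_mul, Polynomial.coeff_X_mul]
  rfl

theorem reducedPower_zero_apply (f : Poly F n) : reducedPower F 0 n f = f := by
  have h : ∀ D, (homogeneousComponent D f).IsHomogeneous D := fun D =>
    homogeneousComponent_isHomogeneous D f
  rw [← sum_homogeneousComponent f, map_sum]
  refine Finset.sum_congr rfl fun D _ => ?_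
  refine homogeneous_induction (motive := fun _ f => reducedPower F 0 n f = f)
    (fun _ => map_zero _) (fun _ f g hf hg => by rw [map_add, hf, hg]) (fun c => ?_)
    (fun D i f _ hf => by rw [reducedPower_zero_X_mul, hf]) (h D)
  simp [reducedPower_C]

theorem reducedPower_eq_zero_of_lt {D k : ℕ} {f : Poly F n} (hf : f.IsHomogeneous D)
    (hk : D < k) : reducedPower F k n f = 0 := by
  refine homogeneous_induction (motive := fun D f => ∀ k, D < k → reducedPower F k n f = 0)
    (fun _ _ _ => map_zero _) (fun _ f g hf hg k hk => by rw [map_add, hf k hk, hg k hk, add_zero])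
    (fun c k hk => by rw [reducedPower_C, if_neg (by omega)])
    (fun D i f _ hf k hk => ?_) hf k hk
  obtain ⟨k, rfl⟩ : ∃ j, k = j + 1 := ⟨k - 1, by omega⟩
  rw [reducedPower_succ_X_mul, hf _ (by omega), hf _ (by omega), mul_zero, mul_zero, add_zero]

theorem one_le_card : 1 ≤ Fintype.card F := Fintype.card_pos

theorem isHomogeneous_reducedPower {D : ℕ} {f : Poly F n} (hf : f.IsHomogeneous D) (k : ℕ) :
    (reducedPower F k n f).IsHomogeneous (D + (Fintype.card F - 1) * k) := by
  refine homogeneous_induction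
    (motive := fun D f => ∀ k, (reducedPower F k n f).IsHomogeneous
      (D + (Fintype.card F - 1) * k))
    (fun _ _ => by rw [map_zero]; exact isHomogeneous_zero _ _ _)
    (fun _ f g hf hg k => by rw [map_add]; exact (hf k).add (hg k))
    (fun c k => ?_) (fun D i f _ hf k => ?_) hf k
  · rw [reducedPower_C]
    split_ifs with h
    · subst h; exact isHomogeneous_C _ _
    · exact isHomogeneous_zero _ _ _
  · cases k with
    | zero =>
      rw [reducedPower_zero_X_mul]
      have := (isHomogeneous_X F i).mul (hf 0)
      convert this using 1
      ring
    | succ k =>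
      rw [reducedPower_succ_X_mul]
      refine IsHomogeneous.add ?_ ?_
      · convert (isHomogeneous_X F i).mul (hf (k + 1)) using 1
        ring
      · convert (isHomogeneous_X_pow i (Fintype.card F)).mul (hf k) using 1
        have := one_le_card (F := F)
        obtain ⟨m, hm⟩ : ∃ m, Fintype.card F = m + 1 := ⟨Fintype.card F - 1, by omega⟩
        rw [hm]
        simp only [Nat.add_sub_cancel]
        ring

/-- The substitution `x ↦ s x + r x ^ q` is the homogenised total operation. -/
theorem aeval_add_pow_eq_sum {B : Type*} [CommRing B] [Algebra F B] (y : Fin n → B) (s r : B)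
    {D : ℕ} {f : Poly F n} (hf : f.IsHomogeneous D) :
    aeval (fun i => s * y i + r * y i ^ Fintype.card F) f =
      ∑ k ∈ Finset.range (D + 1), s ^ (D - k) * r ^ k * aeval y (reducedPower F k n f) := by
  refine homogeneous_induction
    (motive := fun D f => aeval (fun i => s * y i + r * y i ^ Fintype.card F) f =
      ∑ k ∈ Finset.range (D + 1), s ^ (D - k) * r ^ k * aeval y (reducedPower F k n f))
    (fun _ => by simp) (fun _ f g hf hg => ?_) (fun c => ?_) (fun D i f hom hf => ?_) hf
  · rw [map_add, hf, hg, ← Finset.sum_add_distrib]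
    exact Finset.sum_congr rfl fun k _ => by rw [map_add, map_add, mul_add]
  · simp [reducedPower_C]
  · have e1 : ∑ k ∈ Finset.range (D + 1 + 1),
        s ^ (D + 1 - k) * r ^ k * (y i * aeval y (reducedPower F k n f)) =
        s * y i * ∑ k ∈ Finset.range (D + 1),
          s ^ (D - k) * r ^ k * aeval y (reducedPower F k n f) := by
      rw [Finset.sum_range_succ, reducedPower_eq_zero_of_lt hom (Nat.lt_succ_self D), map_zero,
        mul_zero, mul_zero, add_zero, Finset.mul_sum]
      refine Finset.sum_congr rfl fun k hk => ?_
      rw [Finset.mem_range] at hk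
      rw [show D + 1 - k = D - k + 1 by omega]
      ring
    rw [map_mul, aeval_X, hf, add_mul, ← e1, Finset.sum_range_succ' _ (D + 1),
      Finset.sum_range_succ' (fun k => _ * aeval y (reducedPower F k n (X i * f))) (D + 1),
      reducedPower_zero_X_mul, Finset.mul_sum, add_right_comm, ← Finset.sum_add_distrib]
    congr 1
    · refine Finset.sum_congr rfl fun k _ => ?_
      rw [reducedPower_succ_X_mul, map_add, map_mul, map_mul, map_pow, aeval_X,
        Nat.add_sub_add_right]
      ring
    · rw [map_mul, aeval_X]

end ReducedPowers

theorem constantCoeff_apply_zero {F : Type*} [Field F] (θ : Module.End F (Poly F 0)) (f : Poly F 0) :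
    constantCoeff (θ f) = constantCoeff (θ 1) * constantCoeff f := by
  have hf : f = constantCoeff f • (1 : Poly F 0) := by
    rw [MvPolynomial.smul_eq_C_mul, mul_one]
    exact MvPolynomial.eq_C_of_isEmpty f
  conv_lhs => rw [hf, map_smul, MvPolynomial.smul_eq_C_mul, map_mul, constantCoeff_C, mul_comm]

/-! ### Hit elements as the span of the images of the positive P^k. -/

section Hit

variable (F : Type*) [Field F] [Fintype F] (n : ℕ)

/-- The span of the images of the operations `P ^ k` with `k` positive. -/
def hitSubspace : Submodule F (Poly F n) :=
  Submodule.span F {f | ∃ k, 1 ≤ k ∧ ∃ g, f = reducedPower F k n g}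

variable {F n}

theorem reducedPower_mem_hitSubspace {k : ℕ} (hk : 1 ≤ k) (g : Poly F n) :
    reducedPower F k n g ∈ hitSubspace F n :=
  Submodule.subset_span ⟨k, hk, g, rfl⟩

theorem reducedPower_mem_of_mem (k : ℕ) {f : Poly F n} (hf : f ∈ hitSubspace F n) :
    reducedPower F k n f ∈ hitSubspace F n := by
  rcases Nat.eq_zero_or_pos k with rfl | hk
  · rwa [reducedPower_zero_apply]
  · exact reducedPower_mem_hitSubspace hk f

theorem smul_mem_hitSubspace (θ : Steenrod F) {f : Poly F n} (hf : f ∈ hitSubspace F n) :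
    θ • f ∈ hitSubspace F n := by
  obtain ⟨θ, hθ⟩ := θ
  change θ n f ∈ hitSubspace F n
  induction hθ using Algebra.adjoin_induction generalizing f with
  | mem x hx =>
    obtain ⟨k, rfl⟩ := hx
    exact reducedPower_mem_of_mem k hf
  | algebraMap r => exact Submodule.smul_mem _ r hf
  | add x y _ _ hx hy => exact Submodule.add_mem _ (hx hf) (hy hf)
  | mul x y _ _ hx hy => exact hx (hy hf)

/-- Clear on generators. For products, θη - ε(θ)ε(η) = θ(η - ε(η)) + ε(η)(θ - ε(θ)), and θ preserves
the hit subspace. -/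
theorem smul_sub_augmentation_smul_mem (θ : Steenrod F) (f : Poly F n) :
    θ • f - augmentation F θ • f ∈ hitSubspace F n := by
  obtain ⟨θ, hθ⟩ := θ
  change θ n f - constantCoeff (θ 0 1) • f ∈ hitSubspace F n
  induction hθ using Algebra.adjoin_induction generalizing f with
  | mem x hx =>
    obtain ⟨k, rfl⟩ := hx
    change reducedPower F k n f - constantCoeff (reducedPower F k 0 1) • f ∈ _
    rw [← C_1, reducedPower_C]
    split_ifs with hk
    · subst hk
      simp [reducedPower_zero_apply]
    · simpa using reducedPower_mem_hitSubspace (by omega) f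
  | algebraMap r =>
    have h1 : (algebraMap F (∀ m : ℕ, Module.End F (Poly F m)) r) n f = r • f := rfl
    have h2 : (algebraMap F (∀ m : ℕ, Module.End F (Poly F m)) r) 0 1 = r • 1 := rfl
    rw [h1, h2]
    simp [MvPolynomial.smul_eq_C_mul]
  | add x y _ _ hx hy =>
    have := Submodule.add_mem _ (hx f) (hy f)
    convert this using 1
    simp only [Pi.add_apply, LinearMap.add_apply, map_add, add_smul]
    abel
  | mul x y hx' hy' hx hy =>
    have h1 := smul_mem_hitSubspace (⟨x, hx'⟩ : Steenrod F) (hy f)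
    change x n (y n f - constantCoeff (y 0 1) • f) ∈ _ at h1
    have h2 := Submodule.smul_mem _ (constantCoeff (y 0 1)) (hx f)
    have := Submodule.add_mem _ h1 h2
    convert this using 1
    have h3 : constantCoeff ((x * y) 0 1) = constantCoeff (x 0 1) * constantCoeff (y 0 1) :=
      constantCoeff_apply_zero (x 0) (y 0 1)
    rw [h3, map_sub, map_smul, smul_sub, smul_smul, mul_comm (constantCoeff (y 0 1))]
    simp only [Pi.mul_apply, Module.End.mul_apply]
    abel

theorem hit_restrictScalars :
    (hit F (Poly F n)).restrictScalars F = hitSubspace F n := by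
  apply le_antisymm
  · intro x hx
    rw [Submodule.restrictScalars_mem] at hx
    induction hx using Submodule.span_induction with
    | mem x hx =>
      obtain ⟨θ, hθ, m, rfl⟩ := hx
      have := smul_sub_augmentation_smul_mem θ m
      rwa [show augmentation F θ = 0 from hθ, zero_smul, sub_zero] at this
    | zero => exact Submodule.zero_mem _
    | add x y _ _ hx hy => exact Submodule.add_mem _ hx hy
    | smul a x _ hx => exact smul_mem_hitSubspace a hx
  · refine Submodule.span_le.2 ?_
    rintro _ ⟨k, hk, g, rfl⟩
    refine Submodule.subset_span ?_
    refine ⟨⟨fun m => reducedPower F k m, Algebra.subset_adjoin ⟨k, rfl⟩⟩, ?_, g, rfl⟩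
    change constantCoeff (reducedPower F k 0 1) = 0
    rw [← C_1, reducedPower_C, if_neg (by omega), map_zero]

variable (F n)

/-- The indecomposables of degree `d`, as a subspace of the quotient by `hitSubspace`. -/
def cohits (d : ℕ) : Submodule F (Poly F n ⧸ hitSubspace F n) :=
  (homogeneousSubmodule (Fin n) F d).map (hitSubspace F n).mkQ

theorem finrank_indecomposablesDegree (d : ℕ) :
    Module.finrank F (indecomposablesDegree F n d) = Module.finrank F (cohits F n d) := by
  have hker : ∀ f : Poly F n, (hit F (Poly F n)).mkQ.restrictScalars F f = 0 ↔
      (hitSubspace F n).mkQ f = 0 := by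
    intro f
    rw [LinearMap.restrictScalars_apply, Submodule.mkQ_apply, Submodule.mkQ_apply,
      Submodule.Quotient.mk_eq_zero, Submodule.Quotient.mk_eq_zero, ← hit_restrictScalars,
      Submodule.restrictScalars_mem]
  have e1 := (LinearMap.quotKerEquivRange
    (((hit F (Poly F n)).mkQ.restrictScalars F).domRestrict
      (homogeneousSubmodule (Fin n) F d))).finrank_eq
  have e2 := (LinearMap.quotKerEquivRange
    ((hitSubspace F n).mkQ.domRestrict (homogeneousSubmodule (Fin n) F d))).finrank_eq
  rw [LinearMap.range_domRestrict] at e1 e2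
  unfold indecomposablesDegree cohits
  rw [← e1, ← e2]
  have hk : LinearMap.ker (((hit F (Poly F n)).mkQ.restrictScalars F).domRestrict
      (homogeneousSubmodule (Fin n) F d)) =
      LinearMap.ker ((hitSubspace F n).mkQ.domRestrict (homogeneousSubmodule (Fin n) F d)) := by
    ext f
    exact hker f
  rw [hk]

end Hit

/-! ### Bernstein coefficients and binomial coefficients modulo p. -/

section Binomial

/-- The polynomials `(1 - X) ^ (D - k) X ^ k` are linearly independent over every ring. -/
theorem eq_zero_of_sum_bernstein {B : Type*} [CommRing B] {D : ℕ} {h : ℕ → B}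
    (H : ∑ k ∈ Finset.range (D + 1),
      (1 - Polynomial.X) ^ (D - k) * Polynomial.X ^ k * Polynomial.C (h k) = 0)
    {k : ℕ} (hk : k ≤ D) : h k = 0 := by
  induction k using Nat.strong_induction_on with
  | _ k ih =>
    have := congrArg (fun p => Polynomial.coeff p k) H
    simp only [Polynomial.finsetSum_coeff, Polynomial.coeff_zero] at this
    -- In the coefficient of X^k the terms with j > k are divisible by X^(k+1), and those with j < k
    -- vanish by induction.
    rw [Finset.sum_eq_single k] at this
    · rw [mul_right_comm, Polynomial.coeff_mul_X_pow', if_pos le_rfl, Nat.sub_self,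
        Polynomial.mul_coeff_zero, Polynomial.coeff_C_zero] at this
      simpa [Polynomial.coeff_zero_eq_eval_zero] using this
    · intro j _ hj
      rcases lt_or_gt_of_ne hj with hlt | hgt
      · rw [ih j hlt (by omega)]; simp
      · rw [mul_right_comm, Polynomial.coeff_mul_X_pow', if_neg (by omega)]
    · intro hn
      exact absurd (Finset.mem_range.2 (by omega)) hn

/-- Multiplying (1 - X)^a X^b by (X + (1 - X))^(D-a-b) = 1 raises it to Bernstein degree D; then
coefficients can be compared. -/
theorem coeff_eq_of_sum_bernstein {B : Type*} [CommRing B] {D : ℕ} {h : ℕ → B}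
    {ι : Type*} (s : Finset ι) (a b : ι → ℕ) (r : ι → B) (hab : ∀ i ∈ s, a i + b i ≤ D)
    (H : ∑ k ∈ Finset.range (D + 1),
        (1 - Polynomial.X) ^ (D - k) * Polynomial.X ^ k * Polynomial.C (h k) =
      ∑ i ∈ s, (1 - Polynomial.X) ^ a i * Polynomial.X ^ b i * Polynomial.C (r i))
    {k : ℕ} (hk : k ≤ D) :
    h k = ∑ i ∈ s, if b i ≤ k then ((D - (a i + b i)).choose (k - b i) : B) * r i else 0 := by
  have key : ∀ i ∈ s, (1 - Polynomial.X) ^ a i * Polynomial.X ^ b i * Polynomial.C (r i) =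
      ∑ k ∈ Finset.range (D + 1), (1 - Polynomial.X) ^ (D - k) * Polynomial.X ^ k *
        Polynomial.C (if b i ≤ k then ((D - (a i + b i)).choose (k - b i) : B) * r i else 0) := by
    intro i hi
    have hD := hab i hi
    obtain ⟨e, he⟩ := Nat.exists_eq_add_of_le hD
    have h1 : ((Polynomial.X : Polynomial B) + (1 - Polynomial.X)) ^ e = 1 := by
      rw [add_sub_cancel, one_pow]
    rw [add_pow] at h1
    rw [← Finset.sum_subset (s₁ := (Finset.range (e + 1)).map (addRightEmbedding (b i)))]
    · rw [Finset.sum_map]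
      calc _ = (1 - Polynomial.X) ^ a i * Polynomial.X ^ b i * Polynomial.C (r i) *
            ∑ m ∈ Finset.range (e + 1),
              Polynomial.X ^ m * (1 - Polynomial.X) ^ (e - m) * (e.choose m : Polynomial B) := by
              rw [h1, mul_one]
        _ = _ := by
              rw [Finset.mul_sum]
              refine Finset.sum_congr rfl fun m hm => ?_
              rw [Finset.mem_range] at hm
              simp only [addRightEmbedding_apply]
              rw [if_pos (by omega), show D - (m + b i) = a i + (e - m) by omega,
                show D - (a i + b i) = e by omega, Nat.add_sub_cancel, map_mul, pow_add, pow_add,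
                map_natCast]
              ring
    · intro x hx
      simp only [Finset.mem_map, Finset.mem_range, addRightEmbedding_apply] at hx ⊢
      omega
    · intro x hx hx'
      simp only [Finset.mem_map, Finset.mem_range, addRightEmbedding_apply, not_exists,
        not_and] at hx hx'
      split_ifs with hbx
      · rw [Nat.choose_eq_zero_of_lt, Nat.cast_zero, zero_mul, map_zero, mul_zero]
        by_contra hcon
        exact hx' (x - b i) (by omega) (by omega)
      · rw [map_zero, mul_zero]
  rw [Finset.sum_congr rfl key, Finset.sum_comm, ← sub_eq_zero, ← Finset.sum_sub_distrib] at H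
  have := eq_zero_of_sum_bernstein (h := fun k => h k - ∑ i ∈ s,
    if b i ≤ k then ((D - (a i + b i)).choose (k - b i) : B) * r i else 0) (D := D) ?_ hk
  · exact sub_eq_zero.1 this
  · rw [← H]
    refine Finset.sum_congr rfl fun k _ => ?_
    rw [map_sub, mul_sub, map_sum, Finset.mul_sum]

/-- With q = p^r and m = (q-1)(p^s - k) - 1, use C(m, k)(m+1) = C(m+1, k)(m+1-k). The p-adic
valuation of m+1 is exactly that of k, whereas m+1-k = (q-1)p^s - qk has a larger one. This kills
the term without an operation in the local expansions. -/
theorem dvd_choose_of_lt {p r s k : ℕ} (hp : p.Prime) (hr : r ≠ 0) (hk : 0 < k) (hks : k < p ^ s) :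
    p ∣ ((p ^ r - 1) * (p ^ s - k) - 1).choose k := by
  obtain ⟨v, k₁, hk₁, rfl⟩ := Nat.exists_eq_pow_mul_and_not_dvd hk.ne' p hp.ne_one
  have hk₁' : 0 < k₁ := Nat.pos_of_ne_zero (by rintro rfl; simp at hk₁)
  have hv : v < s := by
    refine (Nat.pow_lt_pow_iff_right hp.one_lt).1 (lt_of_le_of_lt ?_ hks)
    exact Nat.le_mul_of_pos_right _ hk₁'
  obtain ⟨e, rfl⟩ : ∃ e, s = v + 1 + e := ⟨s - (v + 1), by omega⟩
  obtain ⟨r, rfl⟩ : ∃ r', r = r' + 1 := ⟨r - 1, by omega⟩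
  set q := p ^ (r + 1) with hq
  have hq2 : 2 ≤ q := le_trans hp.two_le (Nat.le_self_pow (by omega) p)
  have hpos : 1 ≤ (q - 1) * (p ^ (v + 1 + e) - p ^ v * k₁) :=
    Nat.mul_pos (by omega) (by omega)
  set m := (q - 1) * (p ^ (v + 1 + e) - p ^ v * k₁) - 1 with hm
  have hm1 : m + 1 = p ^ v * ((q - 1) * (p ^ (1 + e) - k₁)) := by
    rw [hm, Nat.sub_add_cancel hpos, add_assoc, pow_add p v (1 + e), ← Nat.mul_sub]
    ring
  rcases lt_or_ge m (p ^ v * k₁) with hlt | hge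
  · rw [Nat.choose_eq_zero_of_lt hlt]; exact dvd_zero _
  · have h1 := Nat.choose_mul_succ_eq m (p ^ v * k₁)
    have hk2 : k₁ < p ^ (1 + e) := by
      rw [add_assoc, pow_add] at hks
      exact lt_of_mul_lt_mul_left hks (Nat.zero_le _)
    have h2 : m + 1 - p ^ v * k₁ = p ^ v * (p * ((q - 1) * p ^ e - p ^ r * k₁)) := by
      rw [hm1, ← Nat.mul_sub]
      congr 1
      rw [Nat.mul_sub, Nat.mul_sub, Nat.sub_sub, pow_add p 1 e, pow_one]
      have : (q - 1) * k₁ + k₁ = q * k₁ := by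
        rw [← Nat.succ_mul, Nat.succ_eq_add_one, Nat.sub_add_cancel (by omega)]
      rw [this, hq, pow_succ]
      congr 1 <;> ring
    rw [h2, hm1] at h1
    have h3 : p ∣ m.choose (p ^ v * k₁) * ((q - 1) * (p ^ (1 + e) - k₁)) := by
      have hpv : 0 < p ^ v := Nat.pow_pos hp.pos
      refine ⟨(m + 1).choose (p ^ v * k₁) * ((q - 1) * p ^ e - p ^ r * k₁), ?_⟩
      apply Nat.eq_of_mul_eq_mul_left hpv
      rw [hm1]
      linarith
    rcases (hp.dvd_mul).1 h3 with h | h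
    · exact h
    · exfalso
      rcases (hp.dvd_mul).1 h with h | h
      · have hpq : p ∣ q := by rw [hq, pow_succ]; exact dvd_mul_left _ _
        have := (Nat.dvd_sub hpq h)
        rw [Nat.sub_sub_self (by omega)] at this
        exact hp.one_lt.ne' (Nat.dvd_one.1 this)
      · have hpq : p ∣ p ^ (1 + e) := by rw [pow_add, pow_one]; exact dvd_mul_right _ _
        have := (Nat.dvd_sub hpq h)
        rw [Nat.sub_sub_self hk2.le] at this
        exact hk₁ this

/-- Lucas' theorem, removing one base p digit at a time. -/
theorem choose_pow_mul_sub_one_modEq {p : ℕ} (hp : p.Prime) {c : ℕ} (hc : 0 < c) (v : ℕ) :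
    (p ^ v * c - 1).choose (p ^ v) ≡ c - 1 [MOD p] := by
  have := Fact.mk hp
  induction v with
  | zero => simp; rfl
  | succ v ih =>
    have hpos : 0 < p ^ v * c := Nat.mul_pos (Nat.pow_pos hp.pos) hc
    have h := Choose.choose_modEq_choose_mod_mul_choose_div_nat
      (n := p ^ (v + 1) * c - 1) (k := p ^ (v + 1)) (p := p)
    have h1 : (p ^ (v + 1) * c - 1) / p = p ^ v * c - 1 := by
      have : p ^ (v + 1) * c - 1 = (p - 1) + p * (p ^ v * c - 1) := by
        have h2 : p ^ (v + 1) * c = p * (p ^ v * c - 1) + p := by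
          rw [← Nat.mul_succ, Nat.succ_eq_add_one, Nat.sub_add_cancel hpos]; ring
        have := hp.pos
        omega
      rw [this, Nat.add_mul_div_left _ _ hp.pos, Nat.div_eq_of_lt (by have := hp.pos; omega),
        zero_add]
    have h2 : p ^ (v + 1) / p = p ^ v := by rw [pow_succ, Nat.mul_div_cancel _ hp.pos]
    have h3 : p ^ (v + 1) % p = 0 := by rw [pow_succ]; exact Nat.mul_mod_left _ _
    rw [h1, h2, h3, Nat.choose_zero_right, one_mul] at h
    exact h.trans ih

/-- The upper entry is p^v c - 1 with c ≡ 1 + m₁ modulo p, so the binomial coefficient is congruent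
to m₁. -/
theorem not_dvd_choose {p r s v m₁ : ℕ} (hp : p.Prime) (hr : r ≠ 0) (hm : ¬ p ∣ m₁)
    (hv : v < s) :
    ¬ p ∣ ((p ^ r - 1) * (p ^ s - p ^ v) + p ^ v * m₁ - 1).choose (p ^ v) := by
  obtain ⟨e, rfl⟩ : ∃ e, s = v + (1 + e) := ⟨s - (v + 1), by omega⟩
  have hm' : 0 < m₁ := Nat.pos_of_ne_zero (by rintro rfl; simp at hm)
  have h1 : (p ^ r - 1) * (p ^ (v + (1 + e)) - p ^ v) + p ^ v * m₁ =
      p ^ v * ((p ^ r - 1) * (p ^ (1 + e) - 1) + m₁) := by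
    rw [pow_add, mul_add]
    congr 1
    rw [show p ^ v * p ^ (1 + e) - p ^ v = p ^ v * (p ^ (1 + e) - 1) by rw [Nat.mul_sub, mul_one]]
    ring
  rw [h1]
  intro h
  have h2 := choose_pow_mul_sub_one_modEq hp
    (show 0 < (p ^ r - 1) * (p ^ (1 + e) - 1) + m₁ by omega) v
  have h3 := (Nat.ModEq.dvd_iff h2 dvd_rfl).1 h
  apply hm
  have hr1 : 1 ≤ p ^ r := Nat.pow_pos hp.pos
  have he1 : 1 ≤ p ^ (1 + e) := Nat.pow_pos hp.pos
  zify at h3 ⊢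
  rw [Nat.cast_sub (by omega)] at h3
  push_cast [Nat.cast_sub hr1, Nat.cast_sub he1] at h3
  have h4 : (p : ℤ) ∣ (p : ℤ) ^ r := dvd_pow_self _ hr
  have h5 : (p : ℤ) ∣ (p : ℤ) ^ (1 + e) := dvd_pow_self _ (by omega)
  have h6 : (m₁ : ℤ) = (((p : ℤ) ^ r - 1) * ((p : ℤ) ^ (1 + e) - 1) + m₁ - 1) -
      (p : ℤ) ^ r * (p : ℤ) ^ (1 + e) + (p : ℤ) ^ r + (p : ℤ) ^ (1 + e) := by ring
  rw [h6]
  exact dvd_add (dvd_add (dvd_sub h3 (dvd_mul_of_dvd_left h4 _)) h4) h5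

end Binomial

/-! ### The total operation and powers of the ideal of rational points. -/

section RationalPoints

variable {F : Type*} [Field F] [Fintype F]

theorem add_pow_card {B : Type*} [CommRing B] [Algebra F B] (a b : B) :
    (a + b) ^ Fintype.card F = a ^ Fintype.card F + b ^ Fintype.card F :=
  map_add (FiniteField.frobeniusAlgHom F B) a b

theorem sub_pow_card {B : Type*} [CommRing B] [Algebra F B] (a b : B) :
    (a - b) ^ Fintype.card F = a ^ Fintype.card F - b ^ Fintype.card F :=
  map_sub (FiniteField.frobeniusAlgHom F B) a b

variable (F) in
/-- The product `x ^ q - z ^ (q - 1) x` of the linear forms `x + c z`, where `z` is the first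
variable and `x` one of the others. -/
def orbitForm (N : ℕ) (j : Fin N) : Poly F (N + 1) :=
  X j.succ ^ Fintype.card F - X 0 ^ (Fintype.card F - 1) * X j.succ

variable (F) in
/-- The ideal of the rational points outside the hyperplane `z = 0`. -/
def pointIdeal (N : ℕ) : Ideal (Poly F (N + 1)) := Ideal.span (Set.range (orbitForm F N))

variable {N : ℕ}

theorem isHomogeneous_orbitForm (j : Fin N) :
    (orbitForm F N j).IsHomogeneous (Fintype.card F) := by
  refine (isHomogeneous_X_pow _ _).sub ?_
  have := (isHomogeneous_X_pow (R := F) (0 : Fin (N + 1)) (Fintype.card F - 1)).mul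
    (isHomogeneous_X F j.succ)
  rwa [Nat.sub_add_cancel one_le_card] at this

theorem orbitForm_mem (j : Fin N) : orbitForm F N j ∈ pointIdeal F N :=
  Ideal.subset_span ⟨j, rfl⟩

theorem isHomogeneous_aeval_orbitForm {h : Poly F N} {e : ℕ} (hh : h.IsHomogeneous e) :
    (aeval (orbitForm F N) h).IsHomogeneous (Fintype.card F * e) :=
  hh.aeval _ isHomogeneous_orbitForm

theorem aeval_orbitForm_mem {h : Poly F N} {e : ℕ} (hh : h.IsHomogeneous e) :
    aeval (orbitForm F N) h ∈ pointIdeal F N ^ e := by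
  refine homogeneous_induction
    (motive := fun e h => aeval (orbitForm F N) h ∈ pointIdeal F N ^ e)
    (fun _ => by rw [map_zero]; exact Ideal.zero_mem _)
    (fun _ f g hf hg => by rw [map_add]; exact Ideal.add_mem _ hf hg)
    (fun c => by simp) (fun D i f _ hf => ?_) hh
  rw [map_mul, aeval_X, pow_succ']
  exact Ideal.mul_mem_mul (orbitForm_mem i) hf

variable (F N) in
/-- The unit factor by which the total operation multiplies `z`. -/
def orbitUnit : Polynomial (Poly F (N + 1)) :=
  1 + Polynomial.C (X 0 ^ (Fintype.card F - 1)) * Polynomial.X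

theorem pow_card_eq {B : Type*} [CommMonoid B] (x : B) :
    x ^ Fintype.card F = x ^ (Fintype.card F - 1) * x := by
  rw [← pow_succ, Nat.sub_add_cancel one_le_card]

theorem totalOperation_X_zero :
    totalOperation F (N + 1) (X 0) = orbitUnit F N * Polynomial.C (X 0) := by
  rw [totalOperation_X, orbitUnit, pow_card_eq]
  simp only [map_mul]
  ring

/-- Modulo the ideal, x^q = z^(q-1) x, so every variable is multiplied by the same factor u =
`orbitUnit`; V_j measures the deviation. -/
theorem totalOperation_X_succ (j : Fin N) :
    totalOperation F (N + 1) (X j.succ) = orbitUnit F N * Polynomial.C (X j.succ) +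
      Polynomial.X * Polynomial.C (orbitForm F N j) := by
  rw [totalOperation_X, orbitUnit, orbitForm]
  simp only [map_mul, map_sub]
  ring

/-- Expand (ux + ξV)^q - (uz)^(q-1)(ux + ξV) and use u - z^(q-1)ξ = 1. Consequently the operations
preserve powers of the ideal. -/
theorem totalOperation_orbitForm (j : Fin N) :
    totalOperation F (N + 1) (orbitForm F N j) =
      orbitUnit F N ^ (Fintype.card F - 1) * Polynomial.C (orbitForm F N j) +
      Polynomial.X ^ Fintype.card F * Polynomial.C (orbitForm F N j) ^ Fintype.card F := by
  set q := Fintype.card F with hq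
  have hu : orbitUnit F N ^ q = 1 +
      (Polynomial.C (X 0 ^ (q - 1)) : Polynomial (Poly F (N + 1))) ^ q * Polynomial.X ^ q := by
    rw [orbitUnit, hq, add_pow_card, one_pow, mul_pow]
  have hu1 : orbitUnit F N - 1 =
    (Polynomial.C (X 0 ^ (q - 1)) : Polynomial (Poly F (N + 1))) * Polynomial.X := by
    rw [orbitUnit, hq]; ring
  have hV : Polynomial.C (orbitForm F N j) = Polynomial.C (X j.succ) ^ q -
      Polynomial.C (X 0 ^ (q - 1)) * Polynomial.C (X j.succ) := by
    rw [orbitForm, map_sub, map_mul, map_pow]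
  have hVq : Polynomial.C (orbitForm F N j) ^ q = (Polynomial.C (X j.succ) ^ q) ^ q -
      Polynomial.C (X 0 ^ (q - 1)) ^ q * Polynomial.C (X j.succ) ^ q := by
    rw [hV, hq, sub_pow_card, mul_pow]
  have hq' : orbitUnit F N ^ q = orbitUnit F N ^ (q - 1) * orbitUnit F N := pow_card_eq _
  conv_lhs => rw [orbitForm, map_sub, map_mul, map_pow, map_pow, totalOperation_X_zero,
    totalOperation_X_succ, mul_pow, add_pow_card, mul_pow, mul_pow, ← map_pow Polynomial.C (X 0)]
  rw [← hq, hVq]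
  generalize (Polynomial.C (X 0 ^ (q - 1)) : Polynomial (Poly F (N + 1))) = w at *
  generalize (Polynomial.C (X j.succ) : Polynomial (Poly F (N + 1))) = x at *
  generalize (Polynomial.C (orbitForm F N j) : Polynomial (Poly F (N + 1))) = V at *
  generalize orbitUnit F N = u at *
  generalize u ^ (q - 1) = u' at *
  have e1 : u' * u = 1 + w ^ q * Polynomial.X ^ q := by rw [← hq', hu]
  rw [hu]
  linear_combination (-x ^ q) * e1 - u' * u * hV + u' * V * hu1

variable (F N) in
/-- Polynomials in the formal parameter with coefficients in `pointIdeal`. -/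
def pointIdealX : Ideal (Polynomial (Poly F (N + 1))) :=
  (pointIdeal F N).map Polynomial.C

theorem mem_pointIdealX_pow {e : ℕ} {f : Polynomial (Poly F (N + 1))} :
    f ∈ pointIdealX F N ^ e ↔ ∀ k, f.coeff k ∈ pointIdeal F N ^ e := by
  rw [pointIdealX, ← Ideal.map_pow, Ideal.mem_map_C_iff]

theorem mul_mem_pointIdealX_pow {a b : ℕ} {f g : Polynomial (Poly F (N + 1))}
    (hf : f ∈ pointIdealX F N ^ a) (hg : g ∈ pointIdealX F N ^ b) :
    f * g ∈ pointIdealX F N ^ (a + b) := by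
  rw [mem_pointIdealX_pow] at *
  intro k
  rw [Polynomial.coeff_mul, pow_add]
  exact Ideal.sum_mem _ fun x _ => Ideal.mul_mem_mul (hf _) (hg _)

theorem mem_pointIdealX {f : Polynomial (Poly F (N + 1))} :
    f ∈ pointIdealX F N ^ 1 ↔ f ∈ pointIdealX F N := by
  rw [mem_pointIdealX_pow, pow_one, pointIdealX, Ideal.mem_map_C_iff]

theorem C_mem_pointIdealX_pow {e : ℕ} {f : Poly F (N + 1)} (hf : f ∈ pointIdeal F N ^ e) :
    Polynomial.C f ∈ pointIdealX F N ^ e := by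
  rw [pointIdealX, ← Ideal.map_pow]
  exact Ideal.mem_map_of_mem _ hf

theorem C_orbitForm_mem (j : Fin N) : Polynomial.C (orbitForm F N j) ∈ pointIdealX F N :=
  Ideal.mem_map_of_mem _ (orbitForm_mem j)

theorem totalOperation_sub_mem {D : ℕ} {f : Poly F (N + 1)} (hf : f.IsHomogeneous D) :
    totalOperation F (N + 1) f - orbitUnit F N ^ D * Polynomial.C f ∈ pointIdealX F N := by
  refine homogeneous_induction (motive := fun D f =>
      totalOperation F (N + 1) f - orbitUnit F N ^ D * Polynomial.C f ∈ pointIdealX F N)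
    (fun _ => by simp) (fun _ f g hf hg => ?_) (fun c => ?_) (fun D i f _ hf => ?_) hf
  · convert Ideal.add_mem _ hf hg using 1
    simp only [map_add]
    ring
  · have : totalOperation F (N + 1) (C c) = Polynomial.C (C c) := by
      rw [← MvPolynomial.algebraMap_eq, AlgHom.commutes]; rfl
    simp [this]
  · have hi : totalOperation F (N + 1) (X i) - orbitUnit F N * Polynomial.C (X i) ∈
        pointIdealX F N := by
      refine Fin.cases ?_ (fun j => ?_) i
      · rw [totalOperation_X_zero, sub_self]; exact Ideal.zero_mem _
      · rw [totalOperation_X_succ, add_sub_cancel_left]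
        exact Ideal.mul_mem_left _ _ (C_orbitForm_mem j)
    convert Ideal.add_mem _ (Ideal.mul_mem_left _ (totalOperation F (N + 1) (X i)) hf)
      (Ideal.mul_mem_right (orbitUnit F N ^ D * Polynomial.C f) _ hi) using 1
    simp only [map_mul]
    ring

theorem totalOperation_orbitForm_mem (j : Fin N) :
    totalOperation F (N + 1) (orbitForm F N j) ∈ pointIdealX F N := by
  rw [totalOperation_orbitForm, pow_card_eq (Polynomial.C (orbitForm F N j))]
  exact Ideal.add_mem _ (Ideal.mul_mem_left _ _ (C_orbitForm_mem j))
    (Ideal.mul_mem_left _ _ (Ideal.mul_mem_left _ _ (C_orbitForm_mem j)))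

theorem totalOperation_aeval_orbitForm_mem {e : ℕ} {h : Poly F N} (hh : h.IsHomogeneous e) :
    totalOperation F (N + 1) (aeval (orbitForm F N) h) ∈ pointIdealX F N ^ e := by
  refine homogeneous_induction (motive := fun e h =>
      totalOperation F (N + 1) (aeval (orbitForm F N) h) ∈ pointIdealX F N ^ e)
    (fun _ => by rw [map_zero, map_zero]; exact Ideal.zero_mem _)
    (fun _ f g hf hg => by rw [map_add, map_add]; exact Ideal.add_mem _ hf hg)
    (fun c => by simp) (fun D i f _ hf => ?_) hh
  rw [map_mul, aeval_X, map_mul, add_comm D 1]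
  exact mul_mem_pointIdealX_pow (mem_pointIdealX.2 (totalOperation_orbitForm_mem i)) hf

theorem totalOperation_aeval_orbitForm_sub_mem {e : ℕ} {h : Poly F N} (hh : h.IsHomogeneous e) :
    totalOperation F (N + 1) (aeval (orbitForm F N) h) -
      orbitUnit F N ^ ((Fintype.card F - 1) * e) * Polynomial.C (aeval (orbitForm F N) h) ∈
        pointIdealX F N ^ (e + 1) := by
  refine homogeneous_induction (motive := fun e h =>
      totalOperation F (N + 1) (aeval (orbitForm F N) h) -
      orbitUnit F N ^ ((Fintype.card F - 1) * e) * Polynomial.C (aeval (orbitForm F N) h) ∈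
        pointIdealX F N ^ (e + 1))
    (fun _ => by simp) (fun _ f g hf hg => ?_) (fun c => ?_) (fun D i f hom hf => ?_) hh
  · convert Ideal.add_mem _ hf hg using 1
    simp only [map_add]
    ring
  · have : totalOperation F (N + 1) (C c) = Polynomial.C (C c) := by
      rw [← MvPolynomial.algebraMap_eq, AlgHom.commutes]; rfl
    simp [this]
  · have hi : totalOperation F (N + 1) (orbitForm F N i) -
        orbitUnit F N ^ (Fintype.card F - 1) * Polynomial.C (orbitForm F N i) ∈
        pointIdealX F N ^ 2 := by
      rw [totalOperation_orbitForm, add_sub_cancel_left]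
      -- The remainder contains V^q, which lies in the square of the ideal since q ≥ 2.
      refine Ideal.mul_mem_left _ _ (Ideal.pow_le_pow_right ?_
        (Ideal.pow_mem_pow (C_orbitForm_mem i) _))
      exact Fintype.one_lt_card
    have h1 := mul_mem_pointIdealX_pow (mem_pointIdealX.2 (totalOperation_orbitForm_mem i)) hf
    rw [show 1 + (D + 1) = D + 1 + 1 by ring] at h1
    have h2 := mul_mem_pointIdealX_pow hi (Ideal.mul_mem_left _
      (orbitUnit F N ^ ((Fintype.card F - 1) * D))
      (C_mem_pointIdealX_pow (aeval_orbitForm_mem hom)))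
    rw [show 2 + D = D + 1 + 1 by ring] at h2
    convert Ideal.add_mem _ h1 h2 using 1
    simp only [map_mul, aeval_X]
    ring

theorem coeff_orbitUnit_pow_mul_C (E t : ℕ) (f : Poly F (N + 1)) :
    (orbitUnit F N ^ E * Polynomial.C f).coeff t =
      (E.choose t : F) • (X 0 ^ ((Fintype.card F - 1) * t) * f) := by
  have h : orbitUnit F N =
      (1 + Polynomial.X : Polynomial (Poly F (N + 1))).comp
        (Polynomial.C (X 0 ^ (Fintype.card F - 1)) * Polynomial.X) := by
    simp [orbitUnit]
  rw [Polynomial.coeff_mul_C, h, ← Polynomial.pow_comp, Polynomial.comp_C_mul_X_coeff,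
    Polynomial.coeff_one_add_X_pow, ← pow_mul, Algebra.smul_def, map_natCast]
  ring

/-- Modulo the next power of the ideal, the total operation multiplies h(V) φ by u^((q-1)e + D); the
coefficient of ξ^t is read off from u = 1 + z^(q-1)ξ. -/
theorem reducedPower_aeval_orbitForm_mul_sub_mem {e D t : ℕ} {h : Poly F N}
    (hh : h.IsHomogeneous e) {φ : Poly F (N + 1)} (hφ : φ.IsHomogeneous D) :
    reducedPower F t (N + 1) (aeval (orbitForm F N) h * φ) -
      (((Fintype.card F - 1) * e + D).choose t : F) •
        (aeval (orbitForm F N) h * (X 0 ^ ((Fintype.card F - 1) * t) * φ)) ∈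
      pointIdeal F N ^ (e + 1) := by
  have h1 := mul_mem_pointIdealX_pow (totalOperation_aeval_orbitForm_mem hh)
    (mem_pointIdealX.2 (totalOperation_sub_mem hφ))
  have h2 := Ideal.mul_mem_right (orbitUnit F N ^ D * Polynomial.C φ) _
    (totalOperation_aeval_orbitForm_sub_mem hh)
  have h3 := mem_pointIdealX_pow.1 (Ideal.add_mem _ h1 h2) t
  convert h3 using 1
  rw [reducedPower_apply, mul_left_comm, ← coeff_orbitUnit_pow_mul_C, ← Polynomial.coeff_sub]
  congr 1
  simp only [map_mul]
  ring

theorem reducedPower_aeval_orbitForm_mul_mem {e t : ℕ} {h : Poly F N}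
    (hh : h.IsHomogeneous e) (φ : Poly F (N + 1)) :
    reducedPower F t (N + 1) (aeval (orbitForm F N) h * φ) ∈ pointIdeal F N ^ e := by
  rw [reducedPower_apply, map_mul]
  exact mem_pointIdealX_pow.1
    (Ideal.mul_mem_right _ _ (totalOperation_aeval_orbitForm_mem hh)) t

end RationalPoints

/-! ### Leading terms, and pushing elements up the filtration. -/

section Reduction

variable {F : Type*} [Field F] [Fintype F] {N : ℕ}

/-- A homogeneous element of a power of `pointIdeal` is a combination of products of a form of
that degree in the `orbitForm`s with a homogeneous polynomial. -/
theorem mem_span_of_mem_pointIdeal_pow {B D : ℕ} {f : Poly F (N + 1)}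
    (hf : f ∈ pointIdeal F N ^ B) (hD : f.IsHomogeneous D) :
    f ∈ Submodule.span F {g | ∃ (h : Poly F N) (φ : Poly F (N + 1)) (E : ℕ),
      h.IsHomogeneous B ∧ φ.IsHomogeneous E ∧ Fintype.card F * B + E = D ∧
      g = aeval (orbitForm F N) h * φ} := by
  -- Here p is a form of degree B in the V_j with polynomial coefficients; only the parts of the
  -- coefficients of degree D - qB survive in degree D.
  obtain ⟨p, hp, rfl⟩ := (Ideal.mem_span_pow_iff_exists_isHomogeneous _ _).1 hf
  rw [← homogeneousComponent_eq_self hD, eval_eq, map_sum]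
  refine Submodule.sum_mem _ fun β hβ => ?_
  have hβB : β.degree = B := by
    by_contra hne
    exact (mem_support_iff.1 hβ) (hp.coeff_eq_zero hne)
  have h1 : ∏ i ∈ β.support, orbitForm F N i ^ β i = aeval (orbitForm F N) (monomial β (1 : F)) := by
    rw [aeval_monomial, map_one, one_mul]
    rfl
  have hhom : (monomial β (1 : F)).IsHomogeneous B := isHomogeneous_monomial 1 hβB
  rw [h1, ← sum_homogeneousComponent (coeff β p), Finset.sum_mul, map_sum]
  refine Submodule.sum_mem _ fun i _ => ?_
  have h2 := (homogeneousComponent_isHomogeneous i (coeff β p)).mul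
    (isHomogeneous_aeval_orbitForm hhom)
  rw [homogeneousComponent_of_mem h2]
  split_ifs with h3
  · refine Submodule.subset_span ⟨_, _, i, hhom, homogeneousComponent_isHomogeneous i (coeff β p),
      ?_, mul_comm _ _⟩
    omega
  · exact Submodule.zero_mem _

variable (F) in
/-- The monomial `z ^ k ∏ x_j ^ (α j)`, reduced in the variables `x_j`. -/
def reducedMonomial (k : ℕ) (α : Fin N → Fin (Fintype.card F)) : Poly F (N + 1) :=
  X 0 ^ k * ∏ j, X j.succ ^ (α j : ℕ)

theorem isHomogeneous_reducedMonomial (k : ℕ) (α : Fin N → Fin (Fintype.card F)) :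
    (reducedMonomial F k α).IsHomogeneous (k + ∑ j, (α j : ℕ)) :=
  (isHomogeneous_X_pow _ _).mul (IsHomogeneous.prod _ _ _ fun _ _ => isHomogeneous_X_pow _ _)

theorem exists_reducedMonomial_sub_mem (k : ℕ) (s : Fin N → ℕ) :
    ∃ k' α, k' + ∑ j, (α j : ℕ) = k + ∑ j, s j ∧
      X 0 ^ k * ∏ j, X j.succ ^ s j - reducedMonomial F k' α ∈ pointIdeal F N := by
  induction hm : ∑ j, s j using Nat.strong_induction_on generalizing k s with
  | _ m ih =>
    by_cases hred : ∀ j, s j < Fintype.card F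
    · exact ⟨k, fun j => ⟨s j, hred j⟩, by simp [hm], by simp [reducedMonomial]⟩
    · push Not at hred
      obtain ⟨i, hi⟩ := hred
      set q := Fintype.card F with hq
      have hq2 : 1 < q := Fintype.one_lt_card
      -- Replacing x_i^q by z^(q-1) x_i keeps the degree and lowers the exponent sum of the x_j.
      set s' := Function.update s i (s i - (q - 1)) with hs'
      have hsum : ∑ j, s' j + (q - 1) = m := by
        rw [hs', Finset.sum_update_of_mem (Finset.mem_univ i), ← hm,
          ← Finset.add_sum_erase _ s (Finset.mem_univ i), Finset.sdiff_singleton_eq_erase]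
        omega
      obtain ⟨k', α, h1, h2⟩ := ih (∑ j, s' j) (by omega) (k + (q - 1)) s' rfl
      refine ⟨k', α, by omega, ?_⟩
      have hdiff : X 0 ^ k * ∏ j, X j.succ ^ s j -
          X 0 ^ (k + (q - 1)) * ∏ j, (X j.succ : Poly F (N + 1)) ^ s' j =
          (X 0 ^ k * X i.succ ^ (s i - q) * ∏ j ∈ Finset.univ.erase i, X j.succ ^ s j) *
            orbitForm F N i := by
        rw [← Finset.mul_prod_erase _ _ (Finset.mem_univ i),
          ← Finset.mul_prod_erase _ (fun j => X j.succ ^ s' j) (Finset.mem_univ i),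
          Finset.prod_congr rfl (g := fun j => (X j.succ : Poly F (N + 1)) ^ s j)
            (s₁ := Finset.univ.erase i) (f := fun j => X j.succ ^ s' j)
            (fun j hj => by rw [hs', Function.update_of_ne (Finset.ne_of_mem_erase hj)]),
          hs', Function.update_self, orbitForm, ← hq,
          show s i - (q - 1) = (s i - q) + 1 by omega]
        nth_rw 1 [show s i = (s i - q) + q by omega]
        ring
      have := Ideal.add_mem _ (Ideal.mul_mem_left _
        (X 0 ^ k * X i.succ ^ (s i - q) * ∏ j ∈ Finset.univ.erase i, X j.succ ^ s j)
        (orbitForm_mem (F := F) i)) h2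
      rw [← hdiff] at this
      convert this using 1
      ring

theorem monomial_eq_mul_prod (s : Fin (N + 1) →₀ ℕ) (c : F) :
    monomial s c = c • (X 0 ^ s 0 * ∏ j : Fin N, X j.succ ^ s j.succ) := by
  rw [monomial_eq, Finsupp.prod_fintype _ _ (fun _ => pow_zero _), Fin.prod_univ_succ,
    MvPolynomial.smul_eq_C_mul]

theorem degree_eq_add_sum (s : Fin (N + 1) →₀ ℕ) : s.degree = s 0 + ∑ j : Fin N, s j.succ := by
  rw [Finsupp.degree_eq_sum, Fin.sum_univ_succ]

/-- Modulo `pointIdeal`, homogeneous polynomials are combinations of reduced monomials. -/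
theorem exists_reduced_sub_mem {D : ℕ} {f : Poly F (N + 1)} (hf : f.IsHomogeneous D) :
    ∃ g ∈ Submodule.span F {g | ∃ k α, k + ∑ j, (α j : ℕ) = D ∧ g = reducedMonomial F k α},
      f - g ∈ pointIdeal F N := by
  choose k' α' h1 h2 using exists_reducedMonomial_sub_mem (F := F) (N := N)
  refine ⟨∑ s ∈ f.support, coeff s f • reducedMonomial F (k' (s 0) fun j => s j.succ)
    (α' (s 0) fun j => s j.succ), ?_, ?_⟩
  · refine Submodule.sum_mem _ fun s hs => Submodule.smul_mem _ _ (Submodule.subset_span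
      ⟨_, _, ?_, rfl⟩)
    rw [h1, ← degree_eq_add_sum]
    by_contra hne
    exact (mem_support_iff.1 hs) (hf.coeff_eq_zero hne)
  · nth_rw 1 [f.as_sum]
    rw [← Finset.sum_sub_distrib]
    refine Ideal.sum_mem _ fun s _ => ?_
    rw [monomial_eq_mul_prod, ← smul_sub, MvPolynomial.smul_eq_C_mul]
    exact Ideal.mul_mem_left _ _ (h2 _ _)

theorem isHomogeneous_of_mem_span {n D : ℕ} {S : Set (Poly F n)} {f : Poly F n}
    (hf : f ∈ Submodule.span F S) (hS : ∀ g ∈ S, g.IsHomogeneous D) : f.IsHomogeneous D := by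
  have : Submodule.span F S ≤ homogeneousSubmodule (Fin n) F D :=
    Submodule.span_le.2 fun g hg => (mem_homogeneousSubmodule D g).2 (hS g hg)
  exact (mem_homogeneousSubmodule D f).1 (this hf)

/-- Modulo the next power of `pointIdeal`, homogeneous elements of a power of `pointIdeal` are
combinations of products with reduced monomials. -/
theorem exists_leading_sub_mem {B D : ℕ} {f : Poly F (N + 1)}
    (hf : f ∈ pointIdeal F N ^ B) (hD : f.IsHomogeneous D) :
    ∃ g ∈ Submodule.span F {g | ∃ (h : Poly F N) (k : ℕ) (α : Fin N → Fin (Fintype.card F)),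
      h.IsHomogeneous B ∧ Fintype.card F * B + (k + ∑ j, (α j : ℕ)) = D ∧
      g = aeval (orbitForm F N) h * reducedMonomial F k α},
      f - g ∈ pointIdeal F N ^ (B + 1) := by
  have hspan := mem_span_of_mem_pointIdeal_pow hf hD
  clear hf hD
  induction hspan using Submodule.span_induction with
  | mem x hx =>
    obtain ⟨h, φ, E, hh, hφ, hE, rfl⟩ := hx
    obtain ⟨g, hg, hsub⟩ := exists_reduced_sub_mem hφ
    refine ⟨aeval (orbitForm F N) h * g, ?_, ?_⟩
    · clear hsub
      induction hg using Submodule.span_induction with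
      | mem x hx =>
        obtain ⟨k, α, hk, rfl⟩ := hx
        exact Submodule.subset_span ⟨h, k, α, hh, by omega, rfl⟩
      | zero => rw [mul_zero]; exact Submodule.zero_mem _
      | add x y _ _ hx hy => rw [mul_add]; exact Submodule.add_mem _ hx hy
      | smul a x _ hx => rw [mul_smul_comm]; exact Submodule.smul_mem _ _ hx
    · rw [← mul_sub, pow_succ]
      exact Ideal.mul_mem_mul (aeval_orbitForm_mem hh) hsub
  | zero => exact ⟨0, Submodule.zero_mem _, by simp⟩
  | add x y _ _ hx hy =>
    obtain ⟨g, hg, h1⟩ := hx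
    obtain ⟨g', hg', h1'⟩ := hy
    refine ⟨g + g', Submodule.add_mem _ hg hg', ?_⟩
    rw [add_sub_add_comm]
    exact Ideal.add_mem _ h1 h1'
  | smul a x _ hx =>
    obtain ⟨g, hg, h1⟩ := hx
    refine ⟨a • g, Submodule.smul_mem _ _ hg, ?_⟩
    rw [← smul_sub, MvPolynomial.smul_eq_C_mul]
    exact Ideal.mul_mem_left _ _ h1

variable (F) in
/-- The degree `q ^ K - (K + 1)`. -/
def lowDegree (K : ℕ) : ℕ := Fintype.card F ^ K - (K + 1)

theorem lowDegree_add (K : ℕ) : lowDegree F K + (K + 1) = Fintype.card F ^ K :=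
  Nat.sub_add_cancel (Nat.lt_pow_self Fintype.one_lt_card)

/-- Exhibits d as qA + δ: a form of degree A in the V_j leaves the degree δ = (K+1)(q-1) - 1 for its
cofactor. -/
theorem lowDegree_succ (K : ℕ) : lowDegree F (K + 1) + 1 =
    Fintype.card F * lowDegree F K + (K + 1) * (Fintype.card F - 1) := by
  have h1 := lowDegree_add (F := F) K
  have h2 := lowDegree_add (F := F) (K + 1)
  obtain ⟨q, hq⟩ : ∃ q, Fintype.card F = q + 1 := ⟨Fintype.card F - 1, by
    have := one_le_card (F := F); omega⟩
  rw [hq] at h1 h2 ⊢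
  rw [pow_succ, ← h1] at h2
  simp only [Nat.add_sub_cancel]
  linarith

/-- This form determines the difference D - A for the source degree D of an operation into degree d.
-/
theorem lowDegree_succ' (K : ℕ) : lowDegree F (K + 1) + 1 =
    (Fintype.card F - 1) * Fintype.card F ^ K + lowDegree F K := by
  have h1 := lowDegree_add (F := F) K
  have h2 := lowDegree_add (F := F) (K + 1)
  obtain ⟨q, hq⟩ : ∃ q, Fintype.card F = q + 1 := ⟨Fintype.card F - 1, by
    have := one_le_card (F := F); omega⟩
  rw [hq] at h1 h2 ⊢
  rw [pow_succ] at h2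
  simp only [Nat.add_sub_cancel]
  linarith

theorem sum_reduced_le (α : Fin N → Fin (Fintype.card F)) :
    ∑ j, (α j : ℕ) ≤ N * (Fintype.card F - 1) := by
  have : ∀ j ∈ Finset.univ, (α j : ℕ) ≤ Fintype.card F - 1 := fun j _ => by
    have := (α j).2; omega
  simpa using Finset.sum_le_card_nsmul _ _ _ this

/-- Modulo the image of a single operation, the elements of small powers of `pointIdeal` may be
moved into higher powers. -/
theorem exists_sub_reducedPower_mem {K m : ℕ} (hm : 0 < m) (hmA : m ≤ lowDegree F K)
    {f : Poly F (K + 2)} (hf : f ∈ pointIdeal F (K + 1) ^ (lowDegree F K - m))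
    (hD : f.IsHomogeneous (lowDegree F (K + 1))) :
    ∃ t E, 0 < t ∧ t ≤ m ∧ E + (Fintype.card F - 1) * t = lowDegree F (K + 1) ∧
      ∃ g : Poly F (K + 2), g.IsHomogeneous E ∧
        f - reducedPower F t (K + 2) g ∈ pointIdeal F (K + 1) ^ (lowDegree F K - m + 1) := by
  obtain ⟨p, hchar⟩ := CharP.exists F
  obtain ⟨r, hp, hcard⟩ := FiniteField.card F p
  -- The operation used is P^t, with t = p^v the exact power of p dividing the deficit m.
  obtain ⟨v, m₁, hm₁, hm_eq⟩ := Nat.exists_eq_pow_mul_and_not_dvd hm.ne' p hp.ne_one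
  have hm₁' : 0 < m₁ := Nat.pos_of_ne_zero (by rintro rfl; simp at hm₁)
  have htm : p ^ v ≤ m := hm_eq ▸ Nat.le_mul_of_pos_right _ hm₁'
  have ht0 : 0 < p ^ v := Nat.pow_pos hp.pos
  set q := Fintype.card F with hq
  have hq2 : 1 < q := Fintype.one_lt_card
  have hA := lowDegree_add (F := F) K
  have hd := lowDegree_succ (F := F) K
  have hd' := lowDegree_succ' (F := F) K
  rw [← hq] at hA hd hd'
  set A := lowDegree F K with hAdef
  set d := lowDegree F (K + 1) with hddef
  have hvs : v < (r : ℕ) * K := by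
    refine (Nat.pow_lt_pow_iff_right hp.one_lt).1 ?_
    rw [pow_mul, ← hcard]
    omega
  set t := p ^ v with ht
  have hqt : (q - 1) * t ≤ (q - 1) * m := Nat.mul_le_mul_left _ htm
  have hqm : (q - 1) * m + m = q * m := by
    rw [← Nat.succ_mul, Nat.succ_eq_add_one, Nat.sub_add_cancel hq2.le]
  have hqAm : q * (A - m) + q * m = q * A := by rw [← mul_add, Nat.sub_add_cancel hmA]
  have hqmA : q * m ≤ q * A := Nat.mul_le_mul_left _ hmA
  refine ⟨t, d - (q - 1) * t, ht0, htm, Nat.sub_add_cancel (by omega), ?_⟩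
  obtain ⟨g₀, hg₀, hsub⟩ := exists_leading_sub_mem hf hD
  suffices h : ∃ g : Poly F (K + 2), g.IsHomogeneous (d - (q - 1) * t) ∧
      g₀ - reducedPower F t (K + 2) g ∈ pointIdeal F (K + 1) ^ (A - m + 1) by
    obtain ⟨g, hg, hg'⟩ := h
    refine ⟨g, hg, ?_⟩
    convert Ideal.add_mem _ hsub hg' using 1
    ring
  clear hsub
  induction hg₀ using Submodule.span_induction with
  | mem x hx =>
    obtain ⟨h, k, α, hh, hdeg, rfl⟩ := hx
    have hα : ∑ j, (α j : ℕ) ≤ (K + 1) * (q - 1) := sum_reduced_le α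
    replace hdeg : q * (A - m) + (k + ∑ j, (α j : ℕ)) = d := hdeg
    -- The bound on the α_j forces k ≥ qm - 1 ≥ (q-1)m, so z^((q-1)t) can be split off.
    have hk : (q - 1) * t ≤ k := by omega
    have hφ := isHomogeneous_reducedMonomial (F := F) (k - (q - 1) * t) α
    set c : F := (((q - 1) * (A - m) + (k - (q - 1) * t + ∑ j, (α j : ℕ))).choose t : F) with hc
    have hc0 : c ≠ 0 := by
      rw [hc, Ne, CharP.cast_eq_zero_iff F p]
      -- The exponent of u depends only on degrees, so the same unit c serves for every generator.
      have hE : (q - 1) * (A - m) + (k - (q - 1) * t + ∑ j, (α j : ℕ)) =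
          (p ^ (r : ℕ) - 1) * (p ^ ((r : ℕ) * K) - p ^ v) + p ^ v * m₁ - 1 := by
        rw [pow_mul, ← hcard, ← hm_eq, ← ht]
        have e3 : (q - 1) * (q ^ K - t) = (q - 1) * q ^ K - (q - 1) * t := Nat.mul_sub ..
        have e1 : (q - 1) * (A - m) + (A - m) = q * (A - m) := by
          rw [← Nat.succ_mul, Nat.succ_eq_add_one, Nat.sub_add_cancel hq2.le]
        have e2 : (q - 1) * t ≤ (q - 1) * q ^ K := Nat.mul_le_mul_left _ (by omega)
        omega
      rw [hE]
      exact not_dvd_choose hp r.ne_zero hm₁ hvs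
    refine ⟨c⁻¹ • (aeval (orbitForm F (K + 1)) h * reducedMonomial F (k - (q - 1) * t) α), ?_, ?_⟩
    · rw [MvPolynomial.smul_eq_C_mul]
      refine IsHomogeneous.C_mul ?_ _
      have := (isHomogeneous_aeval_orbitForm hh).mul hφ
      replace this : IsHomogeneous _
        (q * (A - m) + (k - (q - 1) * t + ∑ j, (α j : ℕ))) := this
      convert this using 1
      omega
    · have h1 : reducedPower F t (K + 2) (aeval (orbitForm F (K + 1)) h *
          reducedMonomial F (k - (q - 1) * t) α) - c • (aeval (orbitForm F (K + 1)) h *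
            (X 0 ^ ((q - 1) * t) * reducedMonomial F (k - (q - 1) * t) α)) ∈
          pointIdeal F (K + 1) ^ (A - m + 1) :=
        reducedPower_aeval_orbitForm_mul_sub_mem (t := t) hh hφ
      have h2 : X 0 ^ ((q - 1) * t) * reducedMonomial F (k - (q - 1) * t) α =
          reducedMonomial F k α := by
        rw [reducedMonomial, reducedMonomial, ← mul_assoc, ← pow_add,
          Nat.add_sub_cancel' hk]
      rw [h2] at h1
      have h3 := Ideal.mul_mem_left _ (C (-c⁻¹)) h1
      convert h3 using 1
      rw [← MvPolynomial.smul_eq_C_mul, smul_sub, map_smul, smul_smul, neg_mul,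
        inv_mul_cancel₀ hc0, neg_smul, neg_smul, one_smul]
      ring
  | zero => exact ⟨0, isHomogeneous_zero _ _ _, by simp⟩
  | add x y _ _ hx hy =>
    obtain ⟨g, hg, h1⟩ := hx
    obtain ⟨g', hg', h1'⟩ := hy
    refine ⟨g + g', hg.add hg', ?_⟩
    rw [map_add, add_sub_add_comm]
    exact Ideal.add_mem _ h1 h1'
  | smul a x _ hx =>
    obtain ⟨g, hg, h1⟩ := hx
    refine ⟨a • g, by rw [MvPolynomial.smul_eq_C_mul]; exact hg.C_mul a, ?_⟩
    rw [map_smul, ← smul_sub, MvPolynomial.smul_eq_C_mul]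
    exact Ideal.mul_mem_left _ _ h1

variable (F) in
/-- The span of the images in degree `d` of the operations `P ^ k`, `0 < k < L`. -/
def boundedHits (n L d : ℕ) : Submodule F (Poly F n) :=
  Submodule.span F {f | ∃ k E, 0 < k ∧ k < L ∧ E + (Fintype.card F - 1) * k = d ∧
    ∃ g, g.IsHomogeneous E ∧ f = reducedPower F k n g}

theorem boundedHits_le_hitSubspace (n L d : ℕ) : boundedHits F n L d ≤ hitSubspace F n := by
  refine Submodule.span_le.2 ?_
  rintro _ ⟨k, E, hk, _, _, g, _, rfl⟩
  exact reducedPower_mem_hitSubspace hk g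

/-- Iterates the single step. The indices of the operations are bounded by the deficit; the bound L
is recorded because the descent may use only P^k with k < qj. -/
theorem exists_sub_mem_boundedHits {K L : ℕ} (m : ℕ) (hmL : m < L) (hmA : m ≤ lowDegree F K)
    {f : Poly F (K + 2)} (hf : f ∈ pointIdeal F (K + 1) ^ (lowDegree F K - m))
    (hD : f.IsHomogeneous (lowDegree F (K + 1))) :
    ∃ g ∈ pointIdeal F (K + 1) ^ lowDegree F K, g.IsHomogeneous (lowDegree F (K + 1)) ∧
      f - g ∈ boundedHits F (K + 2) L (lowDegree F (K + 1)) := by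
  induction m generalizing f with
  | zero => exact ⟨f, by simpa using hf, hD, by simp⟩
  | succ m ih =>
    obtain ⟨t, E, ht0, htm, hE, g, hg, hsub⟩ :=
      exists_sub_reducedPower_mem (Nat.succ_pos m) hmA hf hD
    rw [show lowDegree F K - (m + 1) + 1 = lowDegree F K - m by omega] at hsub
    have hPg : (reducedPower F t (K + 2) g).IsHomogeneous (lowDegree F (K + 1)) :=
      hE ▸ isHomogeneous_reducedPower hg t
    obtain ⟨g', hg', hg'D, h2⟩ := ih (by omega) (by omega) hsub (hD.sub hPg)
    refine ⟨g', hg', hg'D, ?_⟩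
    have h3 : reducedPower F t (K + 2) g ∈ boundedHits F (K + 2) L (lowDegree F (K + 1)) :=
      Submodule.subset_span ⟨t, E, ht0, by omega, hE, g, hg, rfl⟩
    convert Submodule.add_mem _ h2 h3 using 1
    ring

end Reduction

/-! ### The inverse total operation, and why high powers of the ideal are hit. -/

section ConjugateOperation

/-- A sum of powers of `q` below `q ^ L` has at least as many carries as the sum of the
corresponding repunits indicates. -/
theorem sum_repunit_add_le {q L : ℕ} (hq : 1 < q) (M : Multiset ℕ)
    (h : (M.map fun m => q ^ m).sum < q ^ L) :
    (M.map fun m => ∑ i ∈ Finset.range m, q ^ i).sum + L ≤ ∑ i ∈ Finset.range L, q ^ i := by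
  have hlt : ∀ m ∈ M, m < L := fun m hm => by
    refine (Nat.pow_lt_pow_iff_right hq).1 (lt_of_le_of_lt ?_ h)
    exact Multiset.single_le_sum (fun _ _ => Nat.zero_le _) _ (Multiset.mem_map_of_mem _ hm)
  -- A repunit is the sum of the integer parts of q^m / q^(i+1). For each i < L these parts add up
  -- to less than q^(L-1-i), which gains 1 for every i.
  have h1 : ∀ m ∈ M, ∑ i ∈ Finset.range m, q ^ i =
      ∑ i ∈ Finset.range L, if i + 1 ≤ m then q ^ (m - (i + 1)) else 0 := fun m hm => by
    rw [← Finset.sum_range_reflect, ← Finset.sum_filter]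
    refine Finset.sum_congr ?_ fun i hi => by
      congr 1
      omega
    ext i
    have := hlt m hm
    simp only [Finset.mem_range, Finset.mem_filter]
    omega
  rw [Multiset.map_congr rfl h1, Multiset.sum_map_sum, ← Finset.sum_range_reflect (fun i => q ^ i)]
  have h2 : ∀ i ∈ Finset.range L,
      (M.map fun m => if i + 1 ≤ m then q ^ (m - (i + 1)) else 0).sum + 1 ≤ q ^ (L - 1 - i) := by
    intro i hi
    rw [Finset.mem_range] at hi
    rw [Nat.succ_le_iff]
    refine Nat.lt_of_mul_lt_mul_left (a := q ^ (i + 1)) ?_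
    rw [← pow_add, show i + 1 + (L - 1 - i) = L by omega, ← Multiset.sum_map_mul_left]
    refine lt_of_le_of_lt (Multiset.sum_map_le_sum_map _ _ fun m _ => ?_) h
    split_ifs with hm
    · rw [← pow_add, Nat.add_sub_cancel' hm]
    · simp
  have h3 := Finset.sum_le_sum h2
  rwa [Finset.sum_add_distrib, Finset.sum_const, Finset.card_range, smul_eq_mul, mul_one] at h3

variable {F : Type*} [Field F] [Fintype F] {n : ℕ}

variable (F n) in
/-- The total operation, extended to polynomials in the formal parameter. -/
def totalOperationX : Polynomial (Poly F n) →+* Polynomial (Poly F n) :=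
  Polynomial.eval₂RingHom (totalOperation F n).toRingHom Polynomial.X

theorem totalOperationX_C (f : Poly F n) :
    totalOperationX F n (Polynomial.C f) = totalOperation F n f :=
  Polynomial.eval₂_C _ _

theorem totalOperationX_X : totalOperationX F n Polynomial.X = Polynomial.X :=
  Polynomial.eval₂_X _ _

/-- The coefficient of ξ^e changes only by positive operations applied to lower coefficients. Thus
an element is hit once it is such a coefficient of the image of some G whose own coefficient
vanishes. -/
theorem coeff_totalOperationX_sub_mem (G : Polynomial (Poly F n)) (e : ℕ) :
    (totalOperationX F n G).coeff e - G.coeff e ∈ hitSubspace F n := by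
  induction G using Polynomial.induction_on' with
  | add p q hp hq =>
    rw [map_add, Polynomial.coeff_add, Polynomial.coeff_add, add_sub_add_comm]
    exact Submodule.add_mem _ hp hq
  | monomial m a =>
    rw [← Polynomial.C_mul_X_pow_eq_monomial, map_mul, map_pow, totalOperationX_C,
      totalOperationX_X, Polynomial.coeff_mul_X_pow', Polynomial.coeff_C_mul_X_pow]
    rcases lt_trichotomy e m with h | h | h
    · rw [if_neg (by omega), if_neg (by omega), sub_zero]; exact Submodule.zero_mem _
    · subst h
      rw [if_pos le_rfl, if_pos rfl, Nat.sub_self, ← reducedPower_apply, reducedPower_zero_apply,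
        sub_self]
      exact Submodule.zero_mem _
    · rw [if_pos h.le, if_neg (by omega), sub_zero, ← reducedPower_apply]
      exact reducedPower_mem_hitSubspace (by omega) _

theorem add_pow_card_pow {B : Type*} [CommRing B] [Algebra F B] (a b : B) (m : ℕ) :
    (a + b) ^ Fintype.card F ^ m = a ^ Fintype.card F ^ m + b ^ Fintype.card F ^ m := by
  induction m with
  | zero => simp
  | succ m ih => rw [pow_succ, pow_mul, ih, add_pow_card, ← pow_mul, ← pow_mul]

variable (F) in
/-- The truncated inverse of the total operation on a variable. -/
def conjugateX (M : ℕ) (i : Fin n) : Polynomial (Poly F n) :=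
  ∑ m ∈ Finset.range (M + 1), (-1) ^ m * Polynomial.X ^ (∑ l ∈ Finset.range m, Fintype.card F ^ l) *
    Polynomial.C (X i) ^ Fintype.card F ^ m

variable (F) in
/-- The quotient of `conjugateX` by the variable. -/
def conjugateQuotient (M : ℕ) (i : Fin n) : Polynomial (Poly F n) :=
  ∑ m ∈ Finset.range (M + 1), (-1) ^ m * Polynomial.X ^ (∑ l ∈ Finset.range m, Fintype.card F ^ l) *
    Polynomial.C (X i) ^ (Fintype.card F ^ m - 1)

theorem conjugateQuotient_mul (M : ℕ) (i : Fin n) :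
    conjugateQuotient F M i * Polynomial.C (X i) = conjugateX F M i := by
  rw [conjugateQuotient, conjugateX, Finset.sum_mul]
  refine Finset.sum_congr rfl fun m _ => ?_
  rw [mul_assoc, ← pow_succ, Nat.sub_add_cancel (Nat.pow_pos one_le_card)]

/-- The total operation sends x^(q^m) to x^(q^m) + ξ^(q^m) x^(q^(m+1)), and consecutive repunits
differ by q^m; the alternating sum telescopes. -/
theorem totalOperationX_conjugateX (M : ℕ) (i : Fin n) :
    totalOperationX F n (conjugateX F M i) = Polynomial.C (X i) +
      (-1 : Polynomial (Poly F n)) ^ M * Polynomial.X ^ (∑ l ∈ Finset.range (M + 1), Fintype.card F ^ l) *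
        Polynomial.C (X i) ^ Fintype.card F ^ (M + 1) := by
  have h : ∀ m, totalOperationX F n (Polynomial.C (X i) ^ Fintype.card F ^ m) =
      Polynomial.C (X i) ^ Fintype.card F ^ m +
        Polynomial.C (X i) ^ Fintype.card F ^ (m + 1) * Polynomial.X ^ Fintype.card F ^ m := by
    intro m
    rw [map_pow, totalOperationX_C, totalOperation_X, add_pow_card_pow, mul_pow, map_pow, ← pow_mul,
      pow_succ' (Fintype.card F) m]
  unfold conjugateX
  induction M with
  | zero =>
    have h0 := h 0
    simp only [pow_zero, pow_one, zero_add] at h0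
    simp [h0, mul_comm]
  | succ M ih =>
    rw [Finset.sum_range_succ, map_add, ih, map_mul, map_mul, h, map_pow, map_pow, map_neg, map_one,
      totalOperationX_X, Finset.sum_range_succ _ (M + 1), pow_add Polynomial.X]
    ring

theorem X_pow_dvd_totalOperationX_conjugateX_sub (M : ℕ) (i : Fin n) :
    Polynomial.X ^ (M + 1) ∣ totalOperationX F n (conjugateX F M i) - Polynomial.C (X i) := by
  rw [totalOperationX_conjugateX, add_sub_cancel_left]
  refine Dvd.dvd.mul_right (Dvd.dvd.mul_left (pow_dvd_pow _ ?_) _) _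
  have : ∀ l ∈ Finset.range (M + 1), 1 ≤ Fintype.card F ^ l := fun l _ => Nat.pow_pos one_le_card
  simpa using Finset.sum_le_sum this

variable (F n) in
/-- The truncated inverse of the total operation. -/
def conjugate (M : ℕ) : Poly F n →ₐ[F] Polynomial (Poly F n) := aeval (conjugateX F M)

theorem X_pow_dvd_totalOperationX_conjugate_sub (M : ℕ) (f : Poly F n) :
    Polynomial.X ^ (M + 1) ∣ totalOperationX F n (conjugate F n M f) - Polynomial.C f := by
  induction f using MvPolynomial.induction_on with
  | C a =>
    have h1 : conjugate F n M (C a) = Polynomial.C (C a) := by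
      rw [← MvPolynomial.algebraMap_eq, AlgHom.commutes]; rfl
    have h2 : totalOperation F n (C a) = Polynomial.C (C a) := by
      rw [← MvPolynomial.algebraMap_eq, AlgHom.commutes]; rfl
    rw [h1, totalOperationX_C, h2, sub_self]
    exact dvd_zero _
  | add p q hp hq =>
    convert dvd_add hp hq using 1
    simp only [map_add]
    ring
  | mul_X p i hp =>
    convert dvd_add (hp.mul_right (totalOperationX F n (conjugateX F M i)))
      ((X_pow_dvd_totalOperationX_conjugateX_sub M i).mul_left (Polynomial.C p)) using 1
    simp only [conjugate, map_mul, aeval_X]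
    ring

/-- Polynomials in the formal parameter whose exponents are sums of `s` repunits. -/
def HasRepunitExponents (s : ℕ) (G : Polynomial (Poly F n)) : Prop :=
  ∀ k, G.coeff k ≠ 0 → ∃ M : Multiset ℕ, M.card = s ∧
    (M.map fun m => ∑ l ∈ Finset.range m, Fintype.card F ^ l).sum = k

theorem HasRepunitExponents.add {s : ℕ} {G G' : Polynomial (Poly F n)}
    (h : HasRepunitExponents s G) (h' : HasRepunitExponents s G') :
    HasRepunitExponents s (G + G') := by
  intro k hk
  by_cases h0 : G.coeff k = 0
  · exact h' k (by rwa [Polynomial.coeff_add, h0, zero_add] at hk)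
  · exact h k h0

theorem HasRepunitExponents.mul {s s' : ℕ} {G G' : Polynomial (Poly F n)}
    (h : HasRepunitExponents s G) (h' : HasRepunitExponents s' G') :
    HasRepunitExponents (s + s') (G * G') := by
  intro k hk
  rw [Polynomial.coeff_mul] at hk
  obtain ⟨x, hx, hne⟩ := Finset.exists_ne_zero_of_sum_ne_zero hk
  obtain ⟨M, hM, h1⟩ := h _ (left_ne_zero_of_mul hne)
  obtain ⟨M', hM', h1'⟩ := h' _ (right_ne_zero_of_mul hne)
  refine ⟨M + M', by rw [Multiset.card_add, hM, hM'], ?_⟩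
  rw [Multiset.map_add, Multiset.sum_add, h1, h1', Finset.HasAntidiagonal.mem_antidiagonal.1 hx]

theorem hasRepunitExponents_C (f : Poly F n) : HasRepunitExponents 0 (Polynomial.C f) := by
  intro k hk
  refine ⟨0, rfl, ?_⟩
  rw [Polynomial.coeff_C] at hk
  by_contra hne
  exact hk (if_neg (fun h => hne (by simp [h])))

theorem hasRepunitExponents_sum (M : ℕ) (c : ℕ → Poly F n) :
    HasRepunitExponents 1 (∑ m ∈ Finset.range (M + 1), (-1) ^ m *
      Polynomial.X ^ (∑ l ∈ Finset.range m, Fintype.card F ^ l) * Polynomial.C (c m)) := by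
  intro k hk
  rw [Polynomial.finsetSum_coeff] at hk
  obtain ⟨m, _, hne⟩ := Finset.exists_ne_zero_of_sum_ne_zero hk
  refine ⟨{m}, by simp, ?_⟩
  rw [Polynomial.coeff_mul_C] at hne
  replace hne := left_ne_zero_of_mul hne
  rw [← Polynomial.C_1, ← Polynomial.C_neg, ← Polynomial.C_pow, Polynomial.coeff_C_mul_X_pow] at hne
  by_contra h
  exact hne (if_neg fun h' => h (by simp [h']))

theorem hasRepunitExponents_conjugateQuotient (M : ℕ) (i : Fin n) :
    HasRepunitExponents 1 (conjugateQuotient F M i) := by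
  have := hasRepunitExponents_sum (F := F) (n := n) M fun m => X i ^ (Fintype.card F ^ m - 1)
  simpa only [map_pow, conjugateQuotient] using this

theorem hasRepunitExponents_conjugate (M : ℕ) {D : ℕ} {f : Poly F n} (hf : f.IsHomogeneous D) :
    HasRepunitExponents D (conjugate F n M f) := by
  refine homogeneous_induction
    (motive := fun D f => HasRepunitExponents D (conjugate F n M f))
    (fun _ k hk => absurd (by simp) hk) (fun D f g hf hg => ?_) (fun c => ?_)
    (fun D i f _ hf => ?_) hf
  · rw [map_add]; exact hf.add hg
  · have h1 : conjugate F n M (C c) = Polynomial.C (C c) := by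
      rw [← MvPolynomial.algebraMap_eq, AlgHom.commutes]; rfl
    rw [h1]
    exact hasRepunitExponents_C _
  · have h1 := hasRepunitExponents_sum (F := F) (n := n) M fun m => X i ^ (Fintype.card F ^ m)
    have h2 : HasRepunitExponents 1 (conjugateX F M i) := by
      simpa only [map_pow, conjugateX] using h1
    rw [map_mul, add_comm, conjugate, aeval_X]
    exact h2.mul hf

variable {N : ℕ}

/-- Y stands for φ/u. In a factor u x_i + ξ V_i the summand u x_i cancels the denominator, and what
remains has degree too small in ξ to reach the required coefficient. So each factor must contribute
ξ V_i. -/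
theorem coeff_totalOperation_rename_mul {e : ℕ} {h : Poly F N} (hh : h.IsHomogeneous e)
    {Y : Polynomial (Poly F (N + 1))} {φ : Poly F (N + 1)}
    (hY : Polynomial.X ^ (e + 1) ∣ Y * orbitUnit F N - Polynomial.C φ) :
    (totalOperation F (N + 1) (rename Fin.succ h) * Y).coeff e =
      aeval (orbitForm F N) h * φ := by
  refine homogeneous_induction (motive := fun e h =>
      (Polynomial.X ^ (e + 1) ∣ Y * orbitUnit F N - Polynomial.C φ) →
      (totalOperation F (N + 1) (rename Fin.succ h) * Y).coeff e = aeval (orbitForm F N) h * φ)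
    (fun _ _ => by simp) (fun D f g hf hg hY => ?_) (fun c hY => ?_)
    (fun D i f hom hf hY => ?_) hh hY
  · rw [map_add, map_add, add_mul, Polynomial.coeff_add, hf hY, hg hY, map_add, add_mul]
  · have h0 := Polynomial.X_pow_dvd_iff.1 hY 0 (by omega)
    rw [Polynomial.coeff_sub, Polynomial.mul_coeff_zero, Polynomial.coeff_C_zero] at h0
    have h1 : (orbitUnit F N).coeff 0 = 1 := by simp [orbitUnit]
    rw [h1, mul_one, sub_eq_zero] at h0
    have h2 : totalOperation F (N + 1) (C c) = Polynomial.C (C c) := by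
      rw [← MvPolynomial.algebraMap_eq, AlgHom.commutes]; rfl
    rw [rename_C, h2, Polynomial.coeff_C_mul, h0, aeval_C, MvPolynomial.algebraMap_eq]
  · have h0 := Polynomial.X_pow_dvd_iff.1
      (hY.mul_left (totalOperation F (N + 1) (rename Fin.succ f))) (D + 1) (by omega)
    rw [mul_sub, Polynomial.coeff_sub, Polynomial.coeff_mul_C, ← reducedPower_apply,
      reducedPower_eq_zero_of_lt (hom.rename_isHomogeneous) (Nat.lt_succ_self D), zero_mul,
      sub_zero] at h0
    have h1 : totalOperation F (N + 1) (rename Fin.succ (X i * f)) * Y =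
        Polynomial.C (X i.succ) *
          (totalOperation F (N + 1) (rename Fin.succ f) * (Y * orbitUnit F N)) +
        Polynomial.C (orbitForm F N i) *
          (totalOperation F (N + 1) (rename Fin.succ f) * Y) * Polynomial.X := by
      rw [map_mul, rename_X, map_mul, totalOperation_X_succ]
      ring
    rw [h1, Polynomial.coeff_add, Polynomial.coeff_C_mul, h0, mul_zero, zero_add,
      Polynomial.coeff_mul_X, Polynomial.coeff_C_mul, hf (dvd_trans (pow_dvd_pow _ (by omega)) hY),
      map_mul, aeval_X, mul_assoc]

/-- The elements of degree `q ^ N - (N + 1)` of a high power of `pointIdeal` are hit. -/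
theorem mem_hitSubspace_of_mem_pointIdeal_pow {K : ℕ} {f : Poly F (K + 2)}
    (hf : f ∈ pointIdeal F (K + 1) ^ (lowDegree F K + 1))
    (hD : f.IsHomogeneous (lowDegree F (K + 1))) : f ∈ hitSubspace F (K + 2) := by
  have hspan := mem_span_of_mem_pointIdeal_pow hf hD
  clear hf hD
  refine (Submodule.span_le (p := hitSubspace F (K + 2))).2 ?_ hspan
  rintro _ ⟨h, φ, E, hh, hφ, hE, rfl⟩
  set e := lowDegree F K + 1 with he
  -- Up to truncation, the last two factors are a preimage of φ/u under the extended total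
  -- operation, so the coefficient of ξ^e in the image of G is h(V) φ.
  set G := Polynomial.C (rename Fin.succ h) *
    (conjugate F (K + 2) e φ * conjugateQuotient F e 0) with hG
  have hY : Polynomial.X ^ (e + 1) ∣
      totalOperationX F (K + 2) (conjugate F (K + 2) e φ * conjugateQuotient F e 0) *
        orbitUnit F (K + 1) - Polynomial.C φ := by
    -- The inverse is applied to φ z and then z is cancelled; since z maps to uz, this produces the
    -- factor 1/u.
    have h1 := X_pow_dvd_totalOperationX_conjugate_sub e (φ * X 0)
    have h2 : totalOperationX F (K + 2) (conjugate F (K + 2) e (φ * X 0)) - Polynomial.C (φ * X 0) =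
        (totalOperationX F (K + 2) (conjugate F (K + 2) e φ * conjugateQuotient F e 0) *
        orbitUnit F (K + 1) - Polynomial.C φ) * Polynomial.C (X 0) := by
      rw [map_mul (conjugate F (K + 2) e), conjugate, aeval_X, ← conjugateQuotient_mul, ← mul_assoc,
        map_mul (totalOperationX F (K + 2)) _ (Polynomial.C (X 0)), totalOperationX_C,
        totalOperation_X_zero, map_mul Polynomial.C]
      ring
    rw [h2, Polynomial.X_pow_dvd_iff] at h1
    rw [Polynomial.X_pow_dvd_iff]
    intro d hd
    have h3 := h1 d hd
    rw [Polynomial.coeff_mul_C] at h3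
    exact (mul_eq_zero.1 h3).resolve_right (X_ne_zero _)
  have h1 := coeff_totalOperationX_sub_mem G e
  have h2 : (totalOperationX F (K + 2) G).coeff e = aeval (orbitForm F (K + 1)) h * φ := by
    rw [hG, map_mul, totalOperationX_C, coeff_totalOperation_rename_mul hh hY]
  -- Otherwise e is a sum of E + 1 repunits, and the corresponding powers of q sum to (q-1)e + E +
  -- 1.
  have h3 : G.coeff e = 0 := by
    by_contra hne
    obtain ⟨M, hM, hMe⟩ := ((hasRepunitExponents_C (rename Fin.succ h)).mul
      ((hasRepunitExponents_conjugate e hφ).mul (hasRepunitExponents_conjugateQuotient e 0))) e hne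
    have hq : 1 < Fintype.card F := Fintype.one_lt_card
    have hA := lowDegree_add (F := F) K
    have hd := lowDegree_succ (F := F) K
    set q := Fintype.card F with hqdef
    have h4 : (M.map fun m => q ^ m).sum = (q - 1) * e + M.card := by
      have h6 : ∀ m, q ^ m = (q - 1) * ∑ l ∈ Finset.range m, q ^ l + 1 := fun m => by
        obtain ⟨r, hr⟩ : ∃ r, q = r + 1 := ⟨q - 1, by omega⟩
        rw [hr, Nat.add_sub_cancel]
        rw [mul_comm, geom_sum_mul_add]
      rw [Multiset.map_congr rfl fun m _ => h6 m, Multiset.sum_map_add, Multiset.sum_map_mul_left,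
        hMe, Multiset.map_const', Multiset.sum_replicate, smul_eq_mul, mul_one]
    -- With the extra power q^K the total is q^(K+1) - 1, just below the bound. The conclusion then
    -- forces e ≤ A, against e = A + 1.
    have h5 := sum_repunit_add_le (L := K + 1) hq (K ::ₘ M) (by
      rw [Multiset.map_cons, Multiset.sum_cons, h4, hM]
      replace hE : q * e + E = lowDegree F (K + 1) := hE
      replace hd : lowDegree F (K + 1) + 1 = q * lowDegree F K + (K + 1) * (q - 1) := hd
      rw [pow_succ, ← hA]
      rw [he] at hE ⊢
      obtain ⟨r, hr⟩ : ∃ r, q = r + 1 := ⟨q - 1, by omega⟩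
      rw [hr] at hE hd ⊢
      rw [Nat.add_sub_cancel] at hd ⊢
      nlinarith)
    rw [Multiset.map_cons, Multiset.sum_cons, hMe, Finset.sum_range_succ] at h5
    omega
  rwa [h2, h3, sub_zero] at h1

end ConjugateOperation

/-! ### Operations acting on the homogeneous components of a local expansion. -/

section Components

variable {F : Type*} [Field F] {N : ℕ}

theorem homogeneousComponent_congr {A : ℕ} {f g : Poly F N}
    (h : f - g ∈ idealOfVars (Fin N) F ^ (A + 1)) :
    homogeneousComponent A f = homogeneousComponent A g := by
  rw [← sub_eq_zero, ← map_sub]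
  ext s
  rw [coeff_homogeneousComponent, coeff_zero]
  split_ifs with hs
  · exact (mem_pow_idealOfVars_iff' _ _).1 h s (by omega)
  · rfl

theorem mem_pow_idealOfVars_of_isHomogeneous {e D : ℕ} {f : Poly F N} (hf : f.IsHomogeneous D)
    (h : e ≤ D) : f ∈ idealOfVars (Fin N) F ^ e := by
  refine (mem_pow_idealOfVars_iff' _ _).2 fun s hs => hf.coeff_eq_zero ?_
  omega

variable [Fintype F]

/-- How the lowest homogeneous components of `ρ f` change under the operations, when `ρ`
intertwines the total operation with the substitution `x ↦ (1 - ξ) x + ξ ^ w x ^ q` up to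
high degrees. -/
theorem homogeneousComponent_reducedPower {n A w D k : ℕ} (hw : 1 ≤ w) (hwq : w ≤ Fintype.card F)
    (ρ : Poly F n →ₐ[F] Poly F N)
    (hρ : ∀ i, aeval (fun j => (1 - Polynomial.X) * Polynomial.C (X j) +
        Polynomial.X ^ w * Polynomial.C (X j : Poly F N) ^ Fintype.card F) (ρ (X i)) -
      ((1 - Polynomial.X) * Polynomial.C (ρ (X i)) +
        Polynomial.X * Polynomial.C (ρ (X i)) ^ Fintype.card F) ∈
      (idealOfVars (Fin N) F ^ (A + 1)).map Polynomial.C)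
    {f : Poly F n} (hf : f.IsHomogeneous D) (hAD : A ≤ D) (hkD : k ≤ D) :
    homogeneousComponent A (ρ (reducedPower F k n f)) =
      ∑ i ∈ Finset.range (k + 1), if (Fintype.card F - 1) * i ≤ A ∧ w * i ≤ k then
        ((D - A + (Fintype.card F - w) * i).choose (k - w * i) : F) •
          reducedPower F i N (homogeneousComponent (A - (Fintype.card F - 1) * i) (ρ f)) else 0 := by
  classical
  set q := Fintype.card F with hq
  have hq1 : 1 ≤ q := one_le_card
  set J := idealOfVars (Fin N) F ^ (A + 1) with hJ
  set π := Ideal.Quotient.mkₐ F J with hπ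
  set m : Polynomial (Poly F N) →ₐ[F] Polynomial (Poly F N ⧸ J) := Polynomial.mapAlgHom π with hm
  have hmC : ∀ g, m (Polynomial.C g) = Polynomial.C (π g) := fun g => Polynomial.map_C _
  have hmX : m Polynomial.X = Polynomial.X := Polynomial.map_X _
  have hπ0 : ∀ g ∈ J, π g = 0 := fun g hg => Ideal.Quotient.eq_zero_iff_mem.2 hg
  have hm0 : ∀ g ∈ J.map Polynomial.C, m g = 0 := by
    intro g hg
    rw [Ideal.mem_map_C_iff] at hg
    ext l
    rw [hm, Polynomial.coe_mapAlgHom, Polynomial.coeff_map, Polynomial.coeff_zero]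
    exact hπ0 _ (hg l)
  set Z : Fin N → Polynomial (Poly F N) := fun j => (1 - Polynomial.X) * Polynomial.C (X j) +
        Polynomial.X ^ w * Polynomial.C (X j : Poly F N) ^ q with hZ
  set R : ℕ → Poly F N := fun l => homogeneousComponent l (ρ f) with hR
  have hRl : ∀ l, (R l).IsHomogeneous l := fun l => homogeneousComponent_isHomogeneous l _
  set L := (ρ f).totalDegree + A + k + 1 with hL
  have hsum : ∑ l ∈ Finset.range L, R l = ρ f := by
    conv_rhs => rw [← sum_homogeneousComponent (ρ f)]
    refine (Finset.sum_subset (Finset.range_subset_range.2 (by omega)) fun l _ hl => ?_).symm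
    rw [Finset.mem_range] at hl
    exact homogeneousComponent_eq_zero _ _ (by omega)
  have hCC : ∀ g : Poly F N, aeval (fun j => Polynomial.C (X j : Poly F N)) g = Polynomial.C g := by
    intro g
    have : (aeval fun j => Polynomial.C (X j : Poly F N) : Poly F N →ₐ[F] _) =
        Polynomial.CAlgHom := by
      ext j
      simp
    rw [this]
    rfl
  have hCρ : ∀ g : Poly F n, aeval (fun i => Polynomial.C (ρ (X i))) g = Polynomial.C (ρ g) := by
    intro g
    have : (aeval fun i => Polynomial.C (ρ (X i)) : Poly F n →ₐ[F] _) =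
        Polynomial.CAlgHom.comp ρ := by
      ext j
      simp
    rw [this]
    rfl
  have hZρ : ∀ g : Poly F n, aeval (fun i => aeval Z (ρ (X i))) g = aeval Z (ρ g) := by
    intro g
    have : (aeval fun i => aeval Z (ρ (X i)) : Poly F n →ₐ[F] _) = (aeval Z).comp ρ := by
      ext j
      simp
    rw [this]
    rfl
  have hmv : ∀ (v : Fin n → Polynomial (Poly F N)) (g : Poly F n),
      m (aeval v g) = aeval (fun i => m (v i)) g := by
    intro v g
    have : m.comp (aeval v : Poly F n →ₐ[F] _) = aeval fun i => m (v i) := by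
      ext j
      simp
    rw [← this]
    rfl
  have hRZ : ∀ l ∈ Finset.range L, aeval Z (R l) = ∑ i ∈ Finset.range L,
      (1 - Polynomial.X) ^ (l - i) * Polynomial.X ^ (w * i) *
        Polynomial.C (reducedPower F i N (R l)) := by
    intro l hl
    rw [Finset.mem_range] at hl
    rw [hZ, aeval_add_pow_eq_sum (B := Polynomial (Poly F N)) (fun j => Polynomial.C (X j))
      (1 - Polynomial.X) (Polynomial.X ^ w) (hRl l)]
    simp only [hCC, ← pow_mul]
    refine Finset.sum_subset (Finset.range_subset_range.2 (by omega)) fun i _ hi => ?_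
    rw [Finset.mem_range] at hi
    rw [reducedPower_eq_zero_of_lt (hRl l) (by omega), map_zero, mul_zero]
  set s := (Finset.range L ×ˢ Finset.range L).filter
    fun x : ℕ × ℕ => x.2 ≤ x.1 ∧ x.1 + (q - 1) * x.2 ≤ A with hs
  have hvanish : ∀ x : ℕ × ℕ, ¬ (x.2 ≤ x.1 ∧ x.1 + (q - 1) * x.2 ≤ A) →
      π (reducedPower F x.2 N (R x.1)) = 0 := by
    intro x hx
    by_cases h : x.2 ≤ x.1
    · exact hπ0 _ (mem_pow_idealOfVars_of_isHomogeneous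
        (isHomogeneous_reducedPower (hRl x.1) x.2) (by rw [← hq]; omega))
    · rw [reducedPower_eq_zero_of_lt (hRl x.1) (by omega), map_zero]
  -- The substituted polynomial is computed modulo degree A + 1 in two ways: before expanding by ρ,
  -- and component by component afterwards.
  have H : ∑ k ∈ Finset.range (D + 1), (1 - Polynomial.X) ^ (D - k) * Polynomial.X ^ k *
        Polynomial.C (π (ρ (reducedPower F k n f))) =
      ∑ x ∈ s, (1 - Polynomial.X) ^ (x.1 - x.2) * Polynomial.X ^ (w * x.2) *
        Polynomial.C (π (reducedPower F x.2 N (R x.1))) := by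
    have h1 := aeval_add_pow_eq_sum (fun i => Polynomial.C (ρ (X i))) (1 - Polynomial.X)
      Polynomial.X hf
    have h2 : m (aeval (fun i => (1 - Polynomial.X) * Polynomial.C (ρ (X i)) +
        Polynomial.X * Polynomial.C (ρ (X i)) ^ q) f) = m (aeval Z (ρ f)) := by
      rw [← hZρ, hmv, hmv]
      congr 2
      funext i
      rw [eq_comm, ← sub_eq_zero, ← map_sub]
      exact hm0 _ (hρ i)
    rw [h1, ← hsum, map_sum, map_sum, Finset.sum_congr rfl hRZ] at h2
    simp only [hCρ, map_sum, map_mul, map_pow, map_sub, map_one, hmC, hmX] at h2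
    rw [h2, hs, Finset.sum_filter_of_ne, Finset.sum_product]
    intro x _ hx
    by_contra hne
    exact hx (by rw [hvanish x hne, map_zero, mul_zero])
  have hab : ∀ x ∈ s, x.1 - x.2 + w * x.2 ≤ A := by
    intro x hx
    obtain ⟨_, h1, h2⟩ := Finset.mem_filter.1 hx
    have h3 : w * x.2 ≤ q * x.2 := Nat.mul_le_mul_right _ hwq
    have h4 : (q - 1) * x.2 + x.2 = q * x.2 := by
      rw [← Nat.succ_mul, Nat.succ_eq_add_one, Nat.sub_add_cancel hq1]
    omega
  have key := coeff_eq_of_sum_bernstein s (fun x => x.1 - x.2) (fun x => w * x.2)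
    (fun x => π (reducedPower F x.2 N (R x.1))) (fun x hx => (hab x hx).trans hAD) H hkD
  have key' : ρ (reducedPower F k n f) - (∑ x ∈ s, if w * x.2 ≤ k then
      ((D - (x.1 - x.2 + w * x.2)).choose (k - w * x.2) : F) • reducedPower F x.2 N (R x.1)
      else 0) ∈ J := by
    rw [← Ideal.Quotient.eq_zero_iff_mem, map_sub, sub_eq_zero]
    change π _ = π _
    rw [key, map_sum]
    refine Finset.sum_congr rfl fun x _ => ?_
    split_ifs
    · rw [map_smul, Nat.cast_smul_eq_nsmul F, nsmul_eq_mul]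
    · rw [map_zero]
  rw [homogeneousComponent_congr key', map_sum]
  -- Only l + (q-1)i = A contributes in degree A; there the Bernstein exponents add up to A -
  -- (q-w)i.
  have e1 : ∀ x ∈ Finset.range L ×ˢ Finset.range L,
      (if x.2 ≤ x.1 ∧ x.1 + (q - 1) * x.2 ≤ A then homogeneousComponent A (if w * x.2 ≤ k then
      ((D - (x.1 - x.2 + w * x.2)).choose (k - w * x.2) : F) • reducedPower F x.2 N (R x.1)
      else 0) else 0) = if x.1 + (q - 1) * x.2 = A then (if w * x.2 ≤ k then
        ((D - A + (q - w) * x.2).choose (k - w * x.2) : F) • reducedPower F x.2 N (R x.1) else 0)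
        else 0 := by
    rintro ⟨l, i⟩ _
    dsimp only
    by_cases hil : i ≤ l
    · have h1 := isHomogeneous_reducedPower (hRl l) i
      replace h1 : (reducedPower F i N (R l)).IsHomogeneous (l + (q - 1) * i) := h1
      by_cases hA : l + (q - 1) * i = A
      · rw [if_pos ⟨hil, hA.le⟩, if_pos hA]
        have h3 : w * i ≤ q * i := Nat.mul_le_mul_right _ hwq
        have h4 : (q - 1) * i + i = q * i := by
          rw [← Nat.succ_mul, Nat.succ_eq_add_one, Nat.sub_add_cancel hq1]
        have h5 : (q - w) * i = q * i - w * i := Nat.sub_mul ..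
        rw [show D - (l - i + w * i) = D - A + (q - w) * i by omega]
        split_ifs
        · rw [map_smul, homogeneousComponent_eq_self (hA ▸ h1)]
        · rw [map_zero]
      · rw [if_neg hA]
        split_ifs
        · rw [map_smul, homogeneousComponent_of_mem h1, if_neg (by omega), smul_zero]
        · rw [map_zero]
        · rfl
    · rw [if_neg (fun h => hil h.1), reducedPower_eq_zero_of_lt (hRl l) (by omega)]
      simp
  rw [hs, Finset.sum_filter, Finset.sum_congr rfl e1, Finset.sum_product_right]
  have e2 : ∀ i ∈ Finset.range L, (∑ l ∈ Finset.range L,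
      if l + (q - 1) * i = A then (if w * i ≤ k then
        ((D - A + (q - w) * i).choose (k - w * i) : F) • reducedPower F i N (R l) else 0)
        else 0) = if (q - 1) * i ≤ A ∧ w * i ≤ k then
        ((D - A + (q - w) * i).choose (k - w * i) : F) •
          reducedPower F i N (R (A - (q - 1) * i)) else 0 := by
    intro i _
    by_cases hA : (q - 1) * i ≤ A
    · rw [Finset.sum_eq_single (A - (q - 1) * i), if_pos (by omega)]
      · simp [hA]
      · intro l _ hl
        rw [if_neg (by omega)]
      · intro h
        exact absurd (Finset.mem_range.2 (by omega)) h
    · rw [if_neg (fun h => hA h.1)]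
      exact Finset.sum_eq_zero fun l _ => if_neg (by omega)
  rw [Finset.sum_congr rfl e2]
  refine (Finset.sum_subset (Finset.range_subset_range.2 (by omega)) fun i _ hi => ?_).symm
  rw [Finset.mem_range] at hi
  refine if_neg fun h => hi ?_
  have := Nat.le_mul_of_pos_left i hw
  omega

end Components

/-! ### Expansions at the rational points in two systems of parameters, and interpolation. -/

section LocalExpansion

variable {F : Type*} [Field F] {N : ℕ}

theorem sub_C_mem_idealOfVars {f : Poly F N} {a : F} (h : constantCoeff f = a) :
    f - C a ∈ idealOfVars (Fin N) F := by
  rw [← pow_one (idealOfVars (Fin N) F), mem_pow_idealOfVars_iff']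
  intro s hs
  have : s = 0 := (Finsupp.degree_eq_zero_iff s).1 (by omega)
  rw [this, coeff_sub, coeff_zero_C, ← h, constantCoeff_eq, sub_self]

variable [Fintype F]

theorem eval_orbitForm (c : Fin N → F) (j : Fin N) :
    eval (Fin.cons 1 c : Fin (N + 1) → F) (orbitForm F N j) = 0 := by
  simp [orbitForm, FiniteField.pow_card]

theorem eval_eq_zero_of_mem_pointIdeal (c : Fin N → F) {f : Poly F (N + 1)}
    (hf : f ∈ pointIdeal F N) : eval (Fin.cons 1 c : Fin (N + 1) → F) f = 0 := by
  have : pointIdeal F N ≤ RingHom.ker (eval (Fin.cons 1 c : Fin (N + 1) → F)) := by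
    refine Ideal.span_le.2 ?_
    rintro _ ⟨j, rfl⟩
    exact eval_orbitForm c j
  exact this hf

theorem eval_reducedMonomial (c : Fin N → F) (k : ℕ) (α : Fin N → Fin (Fintype.card F)) :
    eval (Fin.cons 1 c : Fin (N + 1) → F) (reducedMonomial F k α) = ∏ j, c j ^ (α j : ℕ) := by
  simp [reducedMonomial]

/-- The lowest component of a local expansion at a rational point. -/
theorem homogeneousComponent_aeval_orbitForm_mul (ρ : Poly F (N + 1) →ₐ[F] Poly F N)
    {c : Fin N → F} {κ : F}
    (hc : ∀ i, constantCoeff (ρ (X i)) = (Fin.cons 1 c : Fin (N + 1) → F) i)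
    (hV : ∀ j, ρ (orbitForm F N j) - C κ * X j ∈ idealOfVars (Fin N) F ^ 2)
    {e : ℕ} {h : Poly F N} (hh : h.IsHomogeneous e) (φ : Poly F (N + 1)) :
    homogeneousComponent e (ρ (aeval (orbitForm F N) h * φ)) =
      (κ ^ e * eval (Fin.cons 1 c : Fin (N + 1) → F) φ) • h := by
  have hρC : ∀ a, ρ (C a) = C a := fun a => ρ.commutes a
  have hmem : ∀ {D f}, IsHomogeneous f D → f ∈ idealOfVars (Fin N) F ^ D := fun hf =>
    mem_pow_idealOfVars_of_isHomogeneous hf le_rfl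
  have h1 : ρ (aeval (orbitForm F N) h) - C (κ ^ e) * h ∈ idealOfVars (Fin N) F ^ (e + 1) := by
    refine homogeneous_induction (motive := fun e h =>
        ρ (aeval (orbitForm F N) h) - C (κ ^ e) * h ∈ idealOfVars (Fin N) F ^ (e + 1))
      (fun _ => by simp) (fun D f g hf hg => ?_) (fun a => ?_) (fun D i f hom hf => ?_) hh
    · convert Ideal.add_mem _ hf hg using 1
      simp only [map_add]
      ring
    · rw [aeval_C, MvPolynomial.algebraMap_eq, hρC]
      simp
    · have hVi : ρ (orbitForm F N i) ∈ idealOfVars (Fin N) F := by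
        have h2 : C κ * X i ∈ idealOfVars (Fin N) F := Ideal.mul_mem_left _ _ (by
          simpa using hmem (isHomogeneous_X F i))
        have h3 := Ideal.pow_le_pow_right (one_le_two) (hV i)
        rw [pow_one] at h3
        simpa using Ideal.add_mem _ h3 h2
      have e1 := Ideal.mul_mem_mul hVi hf
      rw [← pow_succ'] at e1
      have e2 := Ideal.mul_mem_mul (hV i) (Ideal.mul_mem_left _ (C (κ ^ D)) (hmem hom))
      rw [← pow_add, show 2 + D = D + 1 + 1 by ring] at e2
      convert Ideal.add_mem _ e1 e2 using 1
      simp only [map_mul, aeval_X, pow_succ]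
      ring
  have hconst : constantCoeff (ρ φ) = eval (Fin.cons 1 c : Fin (N + 1) → F) φ := by
    have : (constantCoeff.comp (ρ : Poly F (N + 1) →+* Poly F N)) =
        eval (Fin.cons 1 c : Fin (N + 1) → F) := by
      refine MvPolynomial.ringHom_ext (fun a => ?_) fun i => ?_
      · simp [hρC]
      · simpa using hc i
    rw [← this]
    rfl
  have h2 := Ideal.mul_mem_mul (Ideal.mul_mem_left _ (C (κ ^ e)) (hmem hh))
    (sub_C_mem_idealOfVars hconst)
  rw [← pow_succ] at h2
  rw [homogeneousComponent_congr (g := (κ ^ e * eval (Fin.cons 1 c : Fin (N + 1) → F) φ) • h),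
    map_smul, homogeneousComponent_eq_self hh]
  convert Ideal.add_mem _ (Ideal.mul_mem_right (ρ φ) _ h1) h2 using 1
  rw [map_mul, MvPolynomial.smul_eq_C_mul, map_mul]
  ring

/-- The expansion at the rational point `(1, c)`. -/
def translation (c : Fin N → F) : Poly F (N + 1) →ₐ[F] Poly F N :=
  aeval (Fin.cons 1 fun j => X j + C (c j) : Fin (N + 1) → Poly F N)

theorem translation_X_zero (c : Fin N → F) : translation c (X 0) = 1 := by simp [translation]

theorem translation_X_succ (c : Fin N → F) (j : Fin N) :
    translation c (X j.succ) = X j + C (c j) := by simp [translation]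

theorem C_pow_card (a : F) : (C a : Poly F N) ^ Fintype.card F = C a := by
  rw [← map_pow, FiniteField.pow_card]

theorem X_pow_mem_sq {d : ℕ} (hd : 2 ≤ d) (j : Fin N) :
    (X j : Poly F N) ^ d ∈ idealOfVars (Fin N) F ^ 2 :=
  mem_pow_idealOfVars_of_isHomogeneous (isHomogeneous_X_pow j d) hd

/-- Since c^q = c, the expansion of V_j is X_j^q - X_j; hence the sign. -/
theorem homogeneousComponent_translation (c : Fin N → F) {e : ℕ} {h : Poly F N}
    (hh : h.IsHomogeneous e) (φ : Poly F (N + 1)) :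
    homogeneousComponent e (translation c (aeval (orbitForm F N) h * φ)) =
      ((-1) ^ e * eval (Fin.cons 1 c : Fin (N + 1) → F) φ) • h := by
  refine homogeneousComponent_aeval_orbitForm_mul _ (fun i => ?_) (fun j => ?_) hh φ
  · refine Fin.cases ?_ (fun j => ?_) i
    · simp [translation_X_zero]
    · simp [translation_X_succ]
  · convert X_pow_mem_sq (F := F) (Fintype.one_lt_card (α := F)) j using 1
    rw [orbitForm, map_sub, map_mul, map_pow, map_pow, translation_X_zero, translation_X_succ,
      add_pow_card, C_pow_card]
    simp

/-- The case w = 1: the substitution fixes 1 and every c_j, so it commutes exactly with translation.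
-/
theorem homogeneousComponent_translation_reducedPower (c : Fin N → F) {A D k : ℕ}
    {f : Poly F (N + 1)} (hf : f.IsHomogeneous D) (hAD : A ≤ D) (hkD : k ≤ D) :
    homogeneousComponent A (translation c (reducedPower F k (N + 1) f)) =
      ∑ i ∈ Finset.range (k + 1), if (Fintype.card F - 1) * i ≤ A ∧ 1 * i ≤ k then
        ((D - A + (Fintype.card F - 1) * i).choose (k - 1 * i) : F) • reducedPower F i N
          (homogeneousComponent (A - (Fintype.card F - 1) * i) (translation c f)) else 0 := by
  refine homogeneousComponent_reducedPower le_rfl one_le_card _ (fun i => ?_) hf hAD hkD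
  convert Ideal.zero_mem _
  refine Fin.cases ?_ (fun j => ?_) i
  · rw [translation_X_zero]
    simp
  · rw [translation_X_succ, map_add Polynomial.C, add_pow_card (Polynomial.C (X j : Poly F N)),
      ← map_pow Polynomial.C (C (c j)), C_pow_card, map_add, aeval_X, aeval_C]
    change _ + Polynomial.C (C (c j)) - _ = _
    ring

variable (F N) in
/-- The truncated solution of `g (x) - g (x) ^ q = x`. -/
def additiveSeries (j : Fin N) : Poly F N := ∑ i ∈ Finset.range N, X j ^ Fintype.card F ^ i

theorem additiveSeries_pow_card (j : Fin N) : additiveSeries F N j ^ Fintype.card F =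
    additiveSeries F N j - X j + X j ^ Fintype.card F ^ N := by
  have h1 := map_sum (FiniteField.frobeniusAlgHom F (Poly F N))
    (fun i => (X j : Poly F N) ^ Fintype.card F ^ i) (Finset.range N)
  have h2 : additiveSeries F N j ^ Fintype.card F =
      ∑ i ∈ Finset.range N, X j ^ Fintype.card F ^ (i + 1) := by
    refine h1.trans (Finset.sum_congr rfl fun i _ => ?_)
    rw [FiniteField.frobeniusAlgHom_apply, ← pow_mul, ← pow_succ]
  have h3 := Finset.sum_range_succ (fun i => (X j : Poly F N) ^ Fintype.card F ^ i) N
  rw [Finset.sum_range_succ', pow_zero, pow_one] at h3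
  rw [h2, additiveSeries]
  linear_combination h3

/-- The expansion at the rational point `(1, c)`, in the local parameters for which the
`orbitForm`s become the variables. -/
def orbitExpansion (c : Fin N → F) : Poly F (N + 1) →ₐ[F] Poly F N :=
  aeval (Fin.cons 1 fun j => C (c j) - additiveSeries F N j : Fin (N + 1) → Poly F N)

theorem orbitExpansion_X_zero (c : Fin N → F) : orbitExpansion c (X 0) = 1 := by
  simp [orbitExpansion]

theorem orbitExpansion_X_succ (c : Fin N → F) (j : Fin N) :
    orbitExpansion c (X j.succ) = C (c j) - additiveSeries F N j := by simp [orbitExpansion]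

theorem homogeneousComponent_orbitExpansion (c : Fin N → F) {e : ℕ} {h : Poly F N}
    (hh : h.IsHomogeneous e) (φ : Poly F (N + 1)) :
    homogeneousComponent e (orbitExpansion c (aeval (orbitForm F N) h * φ)) =
      eval (Fin.cons 1 c : Fin (N + 1) → F) φ • h := by
  have := homogeneousComponent_aeval_orbitForm_mul (orbitExpansion c) (c := c) (κ := 1)
    (fun i => ?_) (fun j => ?_) hh φ
  · rwa [one_pow, one_mul] at this
  · refine Fin.cases ?_ (fun j => ?_) i
    · simp [orbitExpansion_X_zero]
    · simp [orbitExpansion_X_succ, additiveSeries]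
  · have hN : 2 ≤ Fintype.card F ^ N :=
      Nat.one_lt_pow j.pos.ne' (Fintype.one_lt_card (α := F))
    convert Ideal.neg_mem_iff _ |>.2 (X_pow_mem_sq (F := F) hN j) using 1
    rw [orbitForm, map_sub, map_mul, map_pow, map_pow, orbitExpansion_X_zero,
      orbitExpansion_X_succ, sub_pow_card, C_pow_card, additiveSeries_pow_card]
    simp only [one_pow, one_mul, map_one]
    ring

/-- The case w = q. Only P^i with qi ≤ k can now appear, and P^(qi) yields P^i with coefficient 1;
this makes an induction on the index possible. -/
theorem homogeneousComponent_orbitExpansion_reducedPower (c : Fin N → F) {A D k : ℕ}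
    (hA : A < Fintype.card F ^ N)
    {f : Poly F (N + 1)} (hf : f.IsHomogeneous D) (hAD : A ≤ D) (hkD : k ≤ D) :
    homogeneousComponent A (orbitExpansion c (reducedPower F k (N + 1) f)) =
      ∑ i ∈ Finset.range (k + 1), if (Fintype.card F - 1) * i ≤ A ∧ Fintype.card F * i ≤ k then
        ((D - A + (Fintype.card F - Fintype.card F) * i).choose (k - Fintype.card F * i) : F) •
          reducedPower F i N (homogeneousComponent (A - (Fintype.card F - 1) * i)
            (orbitExpansion c f)) else 0 := by
  refine homogeneousComponent_reducedPower one_le_card le_rfl _ (fun i => ?_) hf hAD hkD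
  refine Fin.cases ?_ (fun j => ?_) i
  · rw [orbitExpansion_X_zero]
    simp
  · have hx : Polynomial.C ((X j : Poly F N) ^ Fintype.card F ^ N) ∈
        (idealOfVars (Fin N) F ^ (A + 1)).map Polynomial.C := Ideal.mem_map_of_mem _
      (mem_pow_idealOfVars_of_isHomogeneous (isHomogeneous_X_pow _ _) hA)
    -- Substitution in the additive series telescopes; the truncation leaves the error (ξ - ξ^(q^N))
    -- X_j^(q^N), of degree above A.
    convert Ideal.mul_mem_left _ (Polynomial.X - Polynomial.X ^ Fintype.card F ^ N) hx using 1
    have h1 : ∀ i, ((1 - Polynomial.X) * Polynomial.C (X j) +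
        Polynomial.X ^ Fintype.card F * Polynomial.C (X j : Poly F N) ^ Fintype.card F) ^
          Fintype.card F ^ i =
        Polynomial.C ((X j : Poly F N) ^ Fintype.card F ^ i) +
          (Polynomial.X ^ Fintype.card F ^ (i + 1) *
            Polynomial.C ((X j : Poly F N) ^ Fintype.card F ^ (i + 1)) -
          Polynomial.X ^ Fintype.card F ^ i *
            Polynomial.C ((X j : Poly F N) ^ Fintype.card F ^ i)) := by
      intro i
      have h2 : (1 - Polynomial.X : Polynomial (Poly F N)) ^ Fintype.card F ^ i =
          1 - Polynomial.X ^ Fintype.card F ^ i := by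
        have := add_pow_card_pow (F := F) (1 - Polynomial.X : Polynomial (Poly F N))
          Polynomial.X i
        rw [sub_add_cancel, one_pow] at this
        linear_combination -this
      rw [add_pow_card_pow, mul_pow, mul_pow, h2, ← pow_mul, ← pow_mul, ← pow_succ',
        map_pow, map_pow]
      ring
    rw [orbitExpansion_X_succ, map_sub Polynomial.C, sub_pow_card (Polynomial.C (C (c j))),
      ← map_pow Polynomial.C (C (c j)), ← map_pow Polynomial.C (additiveSeries F N j),
      C_pow_card, additiveSeries_pow_card, map_sub, aeval_C, map_add, map_sub, additiveSeries,
      map_sum]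
    simp only [map_pow (aeval _), aeval_X, h1]
    rw [Finset.sum_add_distrib, Finset.sum_range_sub (fun i =>
      (Polynomial.X : Polynomial (Poly F N)) ^ Fintype.card F ^ i *
        Polynomial.C ((X j : Poly F N) ^ Fintype.card F ^ i)), ← map_sum]
    change Polynomial.C (C (c j)) - _ - _ = _
    simp only [pow_zero, pow_one]
    ring

variable (F N) in
/-- Reduced monomial functions on affine space are linearly independent. -/
theorem linearIndependent_prod_pow : LinearIndependent F
    fun (α : Fin N → Fin (Fintype.card F)) (c : Fin N → F) => ∏ j, c j ^ (α j : ℕ) := by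
  classical
  rw [Fintype.linearIndependent_iff]
  intro g hg α
  set p : Poly F N :=
    ∑ α, monomial (Finsupp.equivFunOnFinite.symm fun j => ((α j : Fin _) : ℕ)) (g α) with hp
  have hp0 : p = 0 := by
    refine eq_zero_of_eval_zero_at_prod_finset p (fun _ => Finset.univ) (fun j => ?_)
      fun c _ => ?_
    · rw [Finset.card_univ]
      refine lt_of_le_of_lt (b := Fintype.card F - 1) ?_ (Nat.sub_lt Fintype.card_pos one_pos)
      rw [hp]
      refine (degreeOf_sum_le j _ _).trans (Finset.sup_le fun α _ => ?_)
      have := (α j).2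
      by_cases h0 : g α = 0
      · simp [h0]
      · rw [degreeOf_monomial_eq _ _ h0, Finsupp.equivFunOnFinite_symm_apply_apply]
        omega
    · have := congrFun hg c
      simp only [Finset.sum_apply, Pi.smul_apply, smul_eq_mul, Pi.zero_apply] at this
      rw [hp, map_sum, ← this]
      refine Finset.sum_congr rfl fun α _ => ?_
      rw [eval_monomial, Finsupp.prod_fintype _ _ fun _ => pow_zero _]
      rfl
  have h1 := congrArg (coeff (Finsupp.equivFunOnFinite.symm fun j => ((α j : Fin _) : ℕ))) hp0
  rw [hp, coeff_sum, coeff_zero, Finset.sum_eq_single α] at h1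
  · simpa using h1
  · intro β _ hβ
    rw [coeff_monomial, if_neg]
    intro h
    refine hβ (funext fun j => Fin.ext ?_)
    exact congrFun (Finsupp.equivFunOnFinite.symm.injective h) j
  · exact fun h => absurd (Finset.mem_univ _) h

variable (F N) in
/-- Interpolation by forms of degree `N (q - 1) - 1` at the rational points `(1, c)`. -/
theorem exists_interpolation : ∃ lam : (Fin N → F) → Poly F (N + 1),
    (∀ c, (lam c).IsHomogeneous (N * (Fintype.card F - 1) - 1)) ∧
    ∀ φ : Poly F (N + 1), φ.IsHomogeneous (N * (Fintype.card F - 1) - 1) →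
      ∑ c, eval (Fin.cons 1 c : Fin (N + 1) → F) φ • lam c - φ ∈ pointIdeal F N := by
  classical
  suffices h : ∃ Λ : ((Fin N → F) → F) →ₗ[F] Poly F (N + 1),
      (∀ u, (Λ u).IsHomogeneous (N * (Fintype.card F - 1) - 1)) ∧
      ∀ φ : Poly F (N + 1), φ.IsHomogeneous (N * (Fintype.card F - 1) - 1) →
        Λ (fun c => eval (Fin.cons 1 c : Fin (N + 1) → F) φ) - φ ∈ pointIdeal F N by
    obtain ⟨Λ, h1, h2⟩ := h
    refine ⟨fun c => Λ fun c' => if c = c' then 1 else 0, fun c => h1 _, fun φ hφ => ?_⟩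
    rw [← LinearMap.pi_apply_eq_sum_univ Λ]
    exact h2 φ hφ
  set δ := N * (Fintype.card F - 1) - 1 with hδ
  have : NeZero (Fintype.card F) := ⟨Fintype.card_ne_zero⟩
  let b := basisOfLinearIndependentOfCardEqFinrank (linearIndependent_prod_pow F N) (by
    simp [Module.finrank_fintype_fun_eq_card])
  have hb : ∀ α, b α = fun c => ∏ j, c j ^ (α j : ℕ) := fun α => by simp [b]
  -- Reduced functions are homogenised to degree δ by powers of z. The value 0 when the exponent sum
  -- exceeds δ is harmless, because forms of degree δ do not involve those functions.
  let v : (Fin N → Fin (Fintype.card F)) → Poly F (N + 1) := fun α =>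
    if ∑ j, (α j : ℕ) ≤ δ then reducedMonomial F (δ - ∑ j, (α j : ℕ)) α else 0
  refine ⟨b.constr F v, fun u => ?_, fun φ hφ => ?_⟩
  · rw [Module.Basis.constr_apply_fintype]
    refine IsHomogeneous.sum _ _ _ fun α _ => ?_
    rw [MvPolynomial.smul_eq_C_mul]
    refine IsHomogeneous.C_mul ?_ _
    simp only [v]
    split_ifs with h
    · convert isHomogeneous_reducedMonomial (F := F) (δ - ∑ j, (α j : ℕ)) α using 1
      omega
    · exact isHomogeneous_zero _ _ _
  · obtain ⟨g, hg, hsub⟩ := exists_reduced_sub_mem hφ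
    have h1 : b.constr F v (fun c => eval (Fin.cons 1 c : Fin (N + 1) → F) g) = g := by
      clear hsub
      induction hg using Submodule.span_induction with
      | mem x hx =>
        obtain ⟨k, α, hk, rfl⟩ := hx
        have h2 : (fun c => eval (Fin.cons 1 c : Fin (N + 1) → F) (reducedMonomial F k α)) =
            b α := by
          rw [hb]
          funext c
          exact eval_reducedMonomial c k α
        rw [h2, Module.Basis.constr_basis]
        simp only [v]
        rw [if_pos (by omega), show δ - ∑ j, (α j : ℕ) = k by omega]
      | zero =>
        simp only [map_zero]
        exact map_zero (b.constr F v)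
      | add x y _ _ hx hy =>
        simp only [map_add]
        exact (map_add (b.constr F v) _ _).trans (congrArg₂ _ hx hy)
      | smul a x _ hx =>
        simp only [MvPolynomial.smul_eval]
        exact (map_smul (b.constr F v) a _).trans (congrArg _ hx)
    have h2 : (fun c => eval (Fin.cons 1 c : Fin (N + 1) → F) φ) =
        fun c => eval (Fin.cons 1 c : Fin (N + 1) → F) g := by
      funext c
      rw [← sub_eq_zero, ← map_sub]
      exact eval_eq_zero_of_mem_pointIdeal c hsub
    rw [h2, h1, ← neg_sub]
    exact neg_mem hsub

end LocalExpansion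

/-! ### Hit coefficients h yield hit products h(V) φ. -/

section Descent

variable {F : Type*} [Field F] [Fintype F] {K : ℕ}

theorem natCast_choose_eq_zero {k : ℕ} (hk : 0 < k) (hkK : k < Fintype.card F ^ K) :
    ((((Fintype.card F - 1) * (Fintype.card F ^ K - k) - 1).choose k : ℕ) : F) = 0 := by
  obtain ⟨p, hchar⟩ := CharP.exists F
  obtain ⟨r, hp, hcard⟩ := FiniteField.card F p
  rw [CharP.cast_eq_zero_iff F p]
  rw [hcard, ← pow_mul] at hkK ⊢
  exact dvd_choose_of_lt hp r.ne_zero hk hkK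

theorem aeval_orbitForm_mul_mem_of_mem {h : Poly F (K + 1)}
    (hh : h.IsHomogeneous (lowDegree F K)) {φ : Poly F (K + 2)}
    (hφ : φ.IsHomogeneous ((K + 1) * (Fintype.card F - 1) - 1)) (hI : φ ∈ pointIdeal F (K + 1)) :
    aeval (orbitForm F (K + 1)) h * φ ∈ hitSubspace F (K + 2) := by
  refine mem_hitSubspace_of_mem_pointIdeal_pow ?_ ?_
  · rw [pow_succ]
    exact Ideal.mul_mem_mul (aeval_orbitForm_mem hh) hI
  · convert (isHomogeneous_aeval_orbitForm hh).mul hφ using 1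
    have h1 := lowDegree_succ (F := F) K
    have h2 : 1 ≤ (K + 1) * (Fintype.card F - 1) :=
      Nat.mul_pos K.succ_pos (Nat.sub_pos_of_lt Fintype.one_lt_card)
    omega

/-- Puts D - A in the shape in which C(D - A, k) vanishes modulo p. -/
theorem lowDegree_sub {D k : ℕ} (hk : k < Fintype.card F ^ K)
    (hD : D + (Fintype.card F - 1) * k = lowDegree F (K + 1)) :
    lowDegree F K ≤ D ∧
      D - lowDegree F K = (Fintype.card F - 1) * (Fintype.card F ^ K - k) - 1 := by
  have h1 := lowDegree_succ' (F := F) K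
  have h2 : (Fintype.card F - 1) * (Fintype.card F ^ K - k) =
    (Fintype.card F - 1) * Fintype.card F ^ K - (Fintype.card F - 1) * k := Nat.mul_sub ..
  have h3 : 1 ≤ (Fintype.card F - 1) * (Fintype.card F ^ K - k) :=
    Nat.mul_pos (Nat.sub_pos_of_lt Fintype.one_lt_card) (Nat.sub_pos_of_lt hk)
  omega

/-- Induction on j, by evaluating ψ on P^(qj)(h(V) φ) in two ways. Here ψ takes the components of
degree A of the orbit expansions and interpolates them back. The action formula gives (P^j h)(V) φ
modulo hits, while pushing up the filtration shows that ψ returns the same hit element modulo hits.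
-/
theorem aeval_orbitForm_reducedPower_mul_mem {j e : ℕ} (hj : 0 < j)
    (hej : e + (Fintype.card F - 1) * j = lowDegree F K) {h : Poly F (K + 1)}
    (hh : h.IsHomogeneous e) {φ : Poly F (K + 2)}
    (hφ : φ.IsHomogeneous ((K + 1) * (Fintype.card F - 1) - 1)) :
    aeval (orbitForm F (K + 1)) (reducedPower F j (K + 1) h) * φ ∈ hitSubspace F (K + 2) := by
  induction j using Nat.strong_induction_on generalizing e h φ with
  | _ j ih =>
  rcases lt_or_ge e j with hlt | hle
  · rw [reducedPower_eq_zero_of_lt hh hlt, map_zero, zero_mul]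
    exact Submodule.zero_mem _
  have hdd := lowDegree_succ (F := F) K
  have hA := lowDegree_add (F := F) K
  have hδ : 1 ≤ (K + 1) * (Fintype.card F - 1) :=
    Nat.mul_pos K.succ_pos (Nat.sub_pos_of_lt Fintype.one_lt_card)
  have hq1 : 1 < Fintype.card F := Fintype.one_lt_card
  have hqmul : ∀ a : ℕ, (Fintype.card F - 1) * a + a = Fintype.card F * a := fun a => by
    rw [← Nat.succ_mul, Nat.succ_eq_add_one, Nat.sub_add_cancel hq1.le]
  have hcomm : (Fintype.card F - 1) * (Fintype.card F * j) =
    Fintype.card F * ((Fintype.card F - 1) * j) := by ring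
  have hqA : Fintype.card F * e + Fintype.card F * ((Fintype.card F - 1) * j) =
    Fintype.card F * lowDegree F K := by rw [← hej, mul_add]
  have hqj := hqmul j
  have hqje : Fintype.card F * j ≤ Fintype.card F * e := Nat.mul_le_mul_left _ hle
  set q := Fintype.card F with hq
  set A := lowDegree F K with hAdef
  set d := lowDegree F (K + 1) with hddef
  set V := orbitForm F (K + 1) with hV
  set δ := (K + 1) * (q - 1) - 1 with hδdef
  obtain ⟨lam, hlam, hinterp⟩ := exists_interpolation F (K + 1)
  let ψ : Poly F (K + 2) →ₗ[F] Poly F (K + 2) := ∑ c, (LinearMap.mulRight F (lam c)) ∘ₗ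
    (aeval V).toLinearMap ∘ₗ (homogeneousComponent A) ∘ₗ (orbitExpansion c).toLinearMap
  have hψ : ∀ f, ψ f = ∑ c, aeval V (homogeneousComponent A (orbitExpansion c f)) * lam c :=
    fun f => by simp [ψ, LinearMap.sum_apply]
  have hsum : ∀ (h' : Poly F (K + 1)) (φ' : Poly F (K + 2)), h'.IsHomogeneous A →
      φ'.IsHomogeneous δ →
      ∑ c, aeval V (eval (Fin.cons 1 c : Fin (K + 2) → F) φ' • h') * lam c - aeval V h' * φ' ∈
        hitSubspace F (K + 2) := by
    intro h' φ' hh' hφ'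
    have e1 : ∑ c, aeval V (eval (Fin.cons 1 c : Fin (K + 2) → F) φ' • h') * lam c -
        aeval V h' * φ' =
        aeval V h' * (∑ c, eval (Fin.cons 1 c : Fin (K + 2) → F) φ' • lam c - φ') := by
      rw [mul_sub, Finset.mul_sum]
      congr 1
      refine Finset.sum_congr rfl fun c _ => ?_
      rw [map_smul, smul_mul_assoc, mul_smul_comm]
    rw [e1]
    refine aeval_orbitForm_mul_mem_of_mem hh' (IsHomogeneous.sub ?_ hφ') (hinterp φ' hφ')
    refine IsHomogeneous.sum _ _ _ fun c _ => ?_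
    rw [MvPolynomial.smul_eq_C_mul]
    exact (hlam c).C_mul _
  -- On I^A, ψ recovers the leading term; the error lies in I^(A+1) and is hit.
  have hfix : ∀ g ∈ pointIdeal F (K + 1) ^ A, g.IsHomogeneous d →
      ψ g - g ∈ hitSubspace F (K + 2) := by
    intro g hg hgd
    have hspan := mem_span_of_mem_pointIdeal_pow hg hgd
    clear hg hgd
    induction hspan using Submodule.span_induction with
    | mem x hx =>
      obtain ⟨h', φ', E, hh', hφ', hE, rfl⟩ := hx
      replace hE : q * A + E = d := hE
      obtain rfl : E = δ := by omega
      convert hsum h' φ' hh' hφ' using 2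
      rw [hψ]
      refine Finset.sum_congr rfl fun c _ => ?_
      rw [homogeneousComponent_orbitExpansion c hh']
    | zero => simp
    | add x y _ _ hx hy =>
      rw [map_add, add_sub_add_comm]
      exact Submodule.add_mem _ hx hy
    | smul a x _ hx =>
      rw [map_smul, ← smul_sub]
      exact Submodule.smul_mem _ a hx
  have hpow : ∀ k D (f : Poly F (K + 2)), 0 < k → k ≤ q * j → D + (q - 1) * k = d →
      f.IsHomogeneous D → k ≤ D → ψ (reducedPower F k (K + 2) f) -
        (if k = q * j then ∑ c, aeval V (reducedPower F j (K + 1)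
          (homogeneousComponent e (orbitExpansion c f))) * lam c else 0) ∈
        hitSubspace F (K + 2) := by
    intro k D f hk hkj hD hf hkD
    have hkK : k < q ^ K := by omega
    obtain ⟨hAD, hDA⟩ := lowDegree_sub hkK hD
    have hzero := natCast_choose_eq_zero (F := F) hk hkK
    have e1 : (if k = q * j then ∑ c, aeval V (reducedPower F j (K + 1)
          (homogeneousComponent e (orbitExpansion c f))) * lam c else 0) =
        ∑ c, aeval V (if k = q * j then (reducedPower F j (K + 1)
          (homogeneousComponent e (orbitExpansion c f))) else 0) * lam c := by
      split_ifs
      · rfl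
      · simp
    rw [hψ, e1, ← Finset.sum_sub_distrib]
    refine Submodule.sum_mem _ fun c _ => ?_
    rw [← sub_mul, ← map_sub]
    have hA1 : A < q ^ (K + 1) := by
      have : q ^ K ≤ q ^ (K + 1) := Nat.pow_le_pow_right (by omega) (by omega)
      omega
    have hform := homogeneousComponent_orbitExpansion_reducedPower c hA1 hf hAD hkD
    have e2 : (if k = q * j then (reducedPower F j (K + 1)
          (homogeneousComponent e (orbitExpansion c f))) else 0) =
        ∑ i ∈ Finset.range (k + 1), if k = q * j ∧ i = j then (reducedPower F j (K + 1)
          (homogeneousComponent e (orbitExpansion c f))) else 0 := by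
      split_ifs with h1
      · rw [Finset.sum_eq_single j]
        · simp [h1]
        · intro i _ hi
          rw [if_neg (fun h => hi h.2)]
        · intro h
          refine absurd (Finset.mem_range.2 ?_) h
          omega
      · exact (Finset.sum_eq_zero fun i _ => if_neg fun h => h1 h.1).symm
    rw [hform, e2, ← Finset.sum_sub_distrib, map_sum, Finset.sum_mul]
    refine Submodule.sum_mem _ fun i _ => ?_
    by_cases hcond : (Fintype.card F - 1) * i ≤ A ∧ Fintype.card F * i ≤ k
    · rw [if_pos hcond]
      obtain ⟨hc1, hc2⟩ := hcond
      replace hc1 : (q - 1) * i ≤ A := hc1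
      replace hc2 : q * i ≤ k := hc2
      -- For i = 0 the binomial coefficient is zero; for 0 < i < j induction applies; i = j forces k
      -- = qj and is the main term.
      rcases Nat.eq_zero_or_pos i with rfl | hi
      · rw [if_neg (by omega), sub_zero, Nat.sub_self, zero_mul, add_zero, mul_zero, Nat.sub_zero,
          hDA, hzero, zero_smul, map_zero, zero_mul]
        exact Submodule.zero_mem _
      · have hij : i ≤ j := Nat.le_of_mul_le_mul_left (hc2.trans hkj) (by omega)
        rcases hij.lt_or_eq with hlt | rfl
        · rw [if_neg (by omega), sub_zero, map_smul, smul_mul_assoc]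
          exact Submodule.smul_mem _ _ (ih i hlt hi (Nat.sub_add_cancel hc1)
            (homogeneousComponent_isHomogeneous _ _) (hlam c))
        · have hk' : k = q * i := le_antisymm hkj hc2
          have e4 : k - Fintype.card F * i = 0 := Nat.sub_eq_zero_of_le hkj
          have e5 : A - (Fintype.card F - 1) * i = e := by
            change A - (q - 1) * i = e
            omega
          rw [if_pos ⟨hk', rfl⟩, e4, Nat.choose_zero_right, Nat.cast_one, one_smul, e5, sub_self,
            map_zero, zero_mul]
          exact Submodule.zero_mem _
    · rw [if_neg hcond, if_neg, sub_zero, map_zero, zero_mul]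
      · exact Submodule.zero_mem _
      · rintro ⟨rfl, rfl⟩
        exact hcond ⟨by change (q - 1) * i ≤ A; omega, le_rfl⟩
  have hbdd : ∀ f ∈ boundedHits F (K + 2) (q * j) d, ψ f ∈ hitSubspace F (K + 2) := by
    intro f hf
    refine (Submodule.span_le (p := (hitSubspace F (K + 2)).comap ψ)).2 ?_ hf
    rintro _ ⟨k, E, hk, hkj, hE, g, hg, rfl⟩
    change ψ (reducedPower F k (K + 2) g) ∈ hitSubspace F (K + 2)
    rcases lt_or_ge E k with hEk | hEk
    · rw [reducedPower_eq_zero_of_lt hg hEk, map_zero]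
      exact Submodule.zero_mem _
    · have := hpow k E g hk hkj.le hE hg hEk
      rwa [if_neg hkj.ne, sub_zero] at this
  have hf : (aeval V h * φ).IsHomogeneous (q * e + δ) := (isHomogeneous_aeval_orbitForm hh).mul hφ
  have hqj0 : 0 < q * j := Nat.mul_pos (by omega) hj
  have hPhom : (reducedPower F (q * j) (K + 2) (aeval V h * φ)).IsHomogeneous d := by
    have := isHomogeneous_reducedPower hf (q * j)
    replace this : IsHomogeneous _ (q * e + δ + (q - 1) * (q * j)) := this
    convert this using 1
    omega
  have hPmem : reducedPower F (q * j) (K + 2) (aeval V h * φ) ∈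
      pointIdeal F (K + 1) ^ (A - (q - 1) * j) := by
    rw [show A - (q - 1) * j = e by omega]
    exact reducedPower_aeval_orbitForm_mul_mem hh φ
  -- The deficit A - e = (q-1)j is less than qj, so only operations controlled by `hbdd` are used.
  obtain ⟨g, hg, hgd, hsub⟩ := exists_sub_mem_boundedHits (K := K) (L := q * j) ((q - 1) * j)
    (by omega) (by omega) hPmem hPhom
  have s1 := hfix g hg hgd
  have s2 := hbdd _ hsub
  have s3 := boundedHits_le_hitSubspace _ _ _ hsub
  have s4 := hpow (q * j) (q * e + δ) _ hqj0 le_rfl (by omega) hf (by omega)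
  have s5 := hsum (reducedPower F j (K + 1) h) φ (by
    rw [← hej]; exact isHomogeneous_reducedPower hh j) hφ
  have e3 : ∑ c, aeval V (reducedPower F j (K + 1)
      (homogeneousComponent e (orbitExpansion c (aeval V h * φ)))) * lam c =
      ∑ c, aeval V (eval (Fin.cons 1 c : Fin (K + 2) → F) φ • reducedPower F j (K + 1) h) *
        lam c := by
    refine Finset.sum_congr rfl fun c _ => ?_
    rw [homogeneousComponent_orbitExpansion c hh, map_smul]
  rw [if_pos rfl, e3] at s4
  have s6 := reducedPower_mem_hitSubspace (k := q * j) hqj0 (aeval V h * φ)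
  rw [map_sub] at s2
  have := Submodule.sub_mem _ (Submodule.sub_mem _ (Submodule.add_mem _ s2 (Submodule.add_mem _ s1
    (Submodule.sub_mem _ s6 s3))) s4) s5
  convert this using 1
  abel

end Descent

/-! ### The recursion for the dimension. -/

section Dimension

variable {F : Type*} [Field F] [Fintype F]

theorem homogeneousComponent_reducedPower_apply {n : ℕ} (d k : ℕ) (f : Poly F n) :
    homogeneousComponent d (reducedPower F k n f) = if (Fintype.card F - 1) * k ≤ d then
      reducedPower F k n (homogeneousComponent (d - (Fintype.card F - 1) * k) f) else 0 := by
  classical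
  have h : ∀ l, homogeneousComponent d (reducedPower F k n (homogeneousComponent l f)) =
      if l + (Fintype.card F - 1) * k = d then
        reducedPower F k n (homogeneousComponent l f) else 0 := by
    intro l
    rw [homogeneousComponent_of_mem
      (isHomogeneous_reducedPower (homogeneousComponent_isHomogeneous l f) k)]
    simp only [eq_comm]
  conv_lhs => rw [← sum_homogeneousComponent f, map_sum, map_sum, Finset.sum_congr rfl fun l _ => h l]
  split_ifs with hd
  · by_cases hl : d - (Fintype.card F - 1) * k < f.totalDegree + 1
    · rw [Finset.sum_eq_single (d - (Fintype.card F - 1) * k), if_pos (by omega)]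
      · intro l _ hl
        rw [if_neg (by omega)]
      · intro h
        exact absurd (Finset.mem_range.2 hl) h
    · rw [homogeneousComponent_eq_zero _ f (by omega), map_zero]
      refine Finset.sum_eq_zero fun l hl' => if_neg ?_
      rw [Finset.mem_range] at hl'
      omega
  · exact Finset.sum_eq_zero fun l _ => if_neg (by omega)

/-- Sending `h` to the class of `h (V) φ`, where `h` has degree `q ^ K - (K + 1)`, is well defined
on classes modulo hit elements. -/
theorem hitSubspace_le_ker {K : ℕ} {φ : Poly F (K + 2)}
    (hφ : φ.IsHomogeneous ((K + 1) * (Fintype.card F - 1) - 1)) :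
    hitSubspace F (K + 1) ≤ LinearMap.ker ((hitSubspace F (K + 2)).mkQ ∘ₗ LinearMap.mulRight F φ ∘ₗ
      (aeval (orbitForm F (K + 1))).toLinearMap ∘ₗ homogeneousComponent (lowDegree F K)) := by
  refine Submodule.span_le.2 ?_
  rintro _ ⟨k, hk, g, rfl⟩
  rw [SetLike.mem_coe, LinearMap.mem_ker]
  simp only [LinearMap.comp_apply, LinearMap.mulRight_apply, AlgHom.toLinearMap_apply]
  rw [Submodule.mkQ_apply, Submodule.Quotient.mk_eq_zero, homogeneousComponent_reducedPower_apply]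
  split_ifs with h
  · exact aeval_orbitForm_reducedPower_mul_mem hk (Nat.sub_add_cancel h)
      (homogeneousComponent_isHomogeneous _ _) hφ
  · simp

/-- In the action formula the terms with i > 0 are visibly hit, and the term i = 0 has coefficient
C(D - A, k) = 0. -/
theorem homogeneousComponent_translation_mem {K : ℕ} (c : Fin (K + 1) → F) {f : Poly F (K + 2)}
    (hf : f ∈ hitSubspace F (K + 2)) :
    homogeneousComponent (lowDegree F K)
      (translation c (homogeneousComponent (lowDegree F (K + 1)) f)) ∈ hitSubspace F (K + 1) := by
  let ψ : Poly F (K + 2) →ₗ[F] Poly F (K + 1) := homogeneousComponent (lowDegree F K) ∘ₗ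
    (translation c).toLinearMap ∘ₗ homogeneousComponent (lowDegree F (K + 1))
  refine (Submodule.span_le (p := (hitSubspace F (K + 1)).comap ψ)).2 ?_ hf
  rintro _ ⟨k, hk, g, rfl⟩
  change homogeneousComponent (lowDegree F K) (translation c
    (homogeneousComponent (lowDegree F (K + 1)) (reducedPower F k (K + 2) g))) ∈ hitSubspace F (K + 1)
  rw [homogeneousComponent_reducedPower_apply]
  split_ifs with h
  · set g' := homogeneousComponent (lowDegree F (K + 1) - (Fintype.card F - 1) * k) g
    have hg' : g'.IsHomogeneous _ := homogeneousComponent_isHomogeneous _ g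
    rcases lt_or_ge (lowDegree F (K + 1) - (Fintype.card F - 1) * k) k with hlt | hle
    · rw [reducedPower_eq_zero_of_lt hg' hlt, map_zero, map_zero]
      exact Submodule.zero_mem _
    -- If k ≥ q^K, the source degree would be less than A, hence less than k, and P^k would vanish.
    have hkK : k < Fintype.card F ^ K := by
      by_contra! hge
      have h1 := lowDegree_succ' (F := F) K
      have h2 := lowDegree_add (F := F) K
      have h3 := Nat.mul_le_mul_left (Fintype.card F - 1) hge
      omega
    obtain ⟨hA, hDA⟩ := lowDegree_sub hkK (Nat.sub_add_cancel h)
    rw [homogeneousComponent_translation_reducedPower c hg' hA hle]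
    refine Submodule.sum_mem _ fun i _ => ?_
    split_ifs
    · rcases Nat.eq_zero_or_pos i with rfl | hi
      · rw [mul_zero, mul_zero, add_zero, Nat.sub_zero, hDA, natCast_choose_eq_zero hk hkK,
          zero_smul]
        exact Submodule.zero_mem _
      · exact Submodule.smul_mem _ _ (reducedPower_mem_hitSubspace hi _)
    · exact Submodule.zero_mem _
  · rw [map_zero, map_zero]
    exact Submodule.zero_mem _

instance (n d : ℕ) : Module.Finite F (cohits F n d) :=
  Module.Finite.iff_fg.2 ((homogeneousSubmodule_fg _ _ d).map _)

/-- The bound excludes exactly one exponent vector, the one with all entries q - 1. -/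
theorem card_sum_reduced_le (N : ℕ) :
    Fintype.card {α : Fin (N + 1) → Fin (Fintype.card F) //
      ∑ j, (α j : ℕ) ≤ (N + 1) * (Fintype.card F - 1) - 1} = Fintype.card F ^ (N + 1) - 1 := by
  classical
  have hq : 1 < Fintype.card F := Fintype.one_lt_card
  let top : Fin (N + 1) → Fin (Fintype.card F) := fun _ => ⟨Fintype.card F - 1, by omega⟩
  have htop : ∀ α : Fin (N + 1) → Fin (Fintype.card F),
      ∑ j, (α j : ℕ) ≤ (N + 1) * (Fintype.card F - 1) - 1 ↔ α ≠ top := by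
    intro α
    have h1 : 1 ≤ (N + 1) * (Fintype.card F - 1) := Nat.mul_pos N.succ_pos (Nat.sub_pos_of_lt hq)
    constructor
    · rintro h rfl
      simp only [top, Finset.sum_const, Finset.card_univ, Fintype.card_fin, smul_eq_mul] at h
      omega
    · intro h
      obtain ⟨i, hi⟩ := Function.ne_iff.1 h
      have h2 : ∑ j, (α j : ℕ) < ∑ _j : Fin (N + 1), (Fintype.card F - 1) := by
        refine Finset.sum_lt_sum (fun j _ => ?_) ⟨i, Finset.mem_univ i, ?_⟩
        · have := (α j).2
          omega
        · have := (α i).2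
          have h3 : (α i : ℕ) ≠ Fintype.card F - 1 := fun h => hi (Fin.ext h)
          omega
      rw [Finset.sum_const, Finset.card_univ, Fintype.card_fin, smul_eq_mul] at h2
      omega
  rw [Fintype.card_congr (Equiv.subtypeEquivRight htop), Fintype.card_subtype_compl,
    Fintype.card_subtype_eq]
  simp

/-- The classes of h(V) μ define an isomorphism from one copy of the smaller space for each reduced
monomial μ of degree δ. -/
theorem finrank_cohits_succ (K : ℕ) :
    Module.finrank F (cohits F (K + 2) (lowDegree F (K + 1))) =
      (Fintype.card F ^ (K + 1) - 1) * Module.finrank F (cohits F (K + 1) (lowDegree F K)) := by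
  set δ := (K + 1) * (Fintype.card F - 1) - 1 with hδ
  set A := lowDegree F K with hA
  set d := lowDegree F (K + 1) with hd
  have hqAδ : Fintype.card F * A + δ = d := by
    have h1 : d + 1 = Fintype.card F * A + (K + 1) * (Fintype.card F - 1) := lowDegree_succ K
    have h2 : 1 ≤ (K + 1) * (Fintype.card F - 1) :=
      Nat.mul_pos K.succ_pos (Nat.sub_pos_of_lt Fintype.one_lt_card)
    omega
  let ι := {α : Fin (K + 1) → Fin (Fintype.card F) // ∑ j, (α j : ℕ) ≤ δ}
  let μ : ι → Poly F (K + 2) := fun α => reducedMonomial F (δ - ∑ j, (α.1 j : ℕ)) α.1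
  have hμ : ∀ α, (μ α).IsHomogeneous δ := fun α => by
    have := isHomogeneous_reducedMonomial (F := F) (δ - ∑ j, (α.1 j : ℕ)) α.1
    rwa [Nat.sub_add_cancel α.2] at this
  let t : ι → (Poly F (K + 1) ⧸ hitSubspace F (K + 1)) →ₗ[F]
      (Poly F (K + 2) ⧸ hitSubspace F (K + 2)) := fun α =>
    (hitSubspace F (K + 1)).liftQ _ (hitSubspace_le_ker (hμ α))
  have ht : ∀ α (h : Poly F (K + 1)), h.IsHomogeneous A →
      t α ((hitSubspace F (K + 1)).mkQ h) =
        (hitSubspace F (K + 2)).mkQ (aeval (orbitForm F (K + 1)) h * μ α) := by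
    intro α h hh
    change (hitSubspace F (K + 2)).mkQ
      (aeval (orbitForm F (K + 1)) (homogeneousComponent A h) * μ α) = _
    rw [homogeneousComponent_eq_self hh]
  let T : (ι → cohits F (K + 1) A) →ₗ[F] (Poly F (K + 2) ⧸ hitSubspace F (K + 2)) :=
    ∑ α, t α ∘ₗ (cohits F (K + 1) A).subtype ∘ₗ LinearMap.proj α
  have hT : ∀ x, T x = ∑ α, t α (x α) := fun x => by simp [T, LinearMap.sum_apply]
  have hrep : ∀ x : ι → cohits F (K + 1) A, ∃ h : ι → Poly F (K + 1),
      (∀ α, (h α).IsHomogeneous A) ∧ ∀ α, (hitSubspace F (K + 1)).mkQ (h α) = x α := by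
    intro x
    choose h h1 h2 using fun α => Submodule.mem_map.1 (x α).2
    exact ⟨h, fun α => (mem_homogeneousSubmodule A _).1 (h1 α), h2⟩
  have hhom : ∀ h : ι → Poly F (K + 1), (∀ α, (h α).IsHomogeneous A) →
      (∑ α, aeval (orbitForm F (K + 1)) (h α) * μ α).IsHomogeneous d := fun h hh =>
    IsHomogeneous.sum _ _ _ fun α _ => hqAδ ▸ (isHomogeneous_aeval_orbitForm (hh α)).mul (hμ α)
  have hTrep : ∀ (x : ι → cohits F (K + 1) A) (h : ι → Poly F (K + 1)),
      (∀ α, (h α).IsHomogeneous A) → (∀ α, (hitSubspace F (K + 1)).mkQ (h α) = x α) →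
      T x = (hitSubspace F (K + 2)).mkQ (∑ α, aeval (orbitForm F (K + 1)) (h α) * μ α) := by
    intro x h hh hx
    rw [hT, map_sum]
    exact Finset.sum_congr rfl fun α _ => by rw [← hx, ht α _ (hh α)]
  -- Expanding a relation at every (1, c) gives a vanishing combination of the classes of the h with
  -- coefficients μ(1, c); independence of these functions is applied after composing with each
  -- linear functional.
  have hinj : Function.Injective T := by
    rw [injective_iff_map_eq_zero]
    intro x hx
    obtain ⟨h, hh, hxh⟩ := hrep x
    rw [hTrep x h hh hxh, Submodule.mkQ_apply, Submodule.Quotient.mk_eq_zero] at hx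
    have h1 : ∀ c : Fin (K + 1) → F, ∑ α : ι, (∏ j, c j ^ (α.1 j : ℕ)) •
        ((x α : cohits F (K + 1) A) : Poly F (K + 1) ⧸ hitSubspace F (K + 1)) = 0 := by
      intro c
      have h2 := homogeneousComponent_translation_mem c hx
      rw [homogeneousComponent_eq_self (hhom h hh), map_sum, map_sum, Finset.sum_congr rfl
        fun α _ => homogeneousComponent_translation c (hh α) (μ α)] at h2
      simp only [mul_smul] at h2
      rw [← Finset.smul_sum, Submodule.smul_mem_iff _ (pow_ne_zero _ (neg_ne_zero.2 one_ne_zero)),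
        ← Submodule.Quotient.mk_eq_zero, ← Submodule.mkQ_apply, map_sum] at h2
      rw [← h2]
      refine Finset.sum_congr rfl fun α _ => ?_
      rw [map_smul, hxh, eval_reducedMonomial]
    funext α
    refine Subtype.ext ((Module.forall_dual_apply_eq_zero_iff F _).1 fun ℓ => ?_)
    have hli := (linearIndependent_prod_pow F (K + 1)).comp (Subtype.val : ι → _)
      Subtype.val_injective
    refine Fintype.linearIndependent_iff.1 hli (fun α => ℓ (x α)) ?_ α
    funext c
    have h2 := congrArg ℓ (h1 c)
    rw [map_sum, map_zero] at h2
    simp only [map_smul, smul_eq_mul] at h2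
    simp only [Finset.sum_apply, Pi.smul_apply, Function.comp_apply, smul_eq_mul, Pi.zero_apply]
    rw [← h2]
    exact Finset.sum_congr rfl fun α _ => mul_comm _ _
  have hrange : LinearMap.range T = cohits F (K + 2) d := by
    apply le_antisymm
    · rintro _ ⟨x, rfl⟩
      obtain ⟨h, hh, hxh⟩ := hrep x
      rw [hTrep x h hh hxh]
      exact Submodule.mem_map_of_mem ((mem_homogeneousSubmodule d _).2 (hhom h hh))
    · rintro _ ⟨f, hf, rfl⟩
      replace hf : f.IsHomogeneous d := (mem_homogeneousSubmodule d f).1 hf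
      -- Deficit A means starting from the zeroth power of the ideal, so f is arbitrary.
      obtain ⟨g, hg, hgd, hsub⟩ := exists_sub_mem_boundedHits (K := K) (L := A + 1) A
        (Nat.lt_succ_self A) le_rfl (f := f) (by simp [← hA]) hf
      obtain ⟨g', hg', hsub'⟩ := exists_leading_sub_mem hg hgd
      have hg'd : g'.IsHomogeneous d := isHomogeneous_of_mem_span hg' (by
        rintro _ ⟨h, k, α, hh, hk, rfl⟩
        rw [hd, ← hk]
        exact (isHomogeneous_aeval_orbitForm hh).mul (isHomogeneous_reducedMonomial k α))
      have h1 := Submodule.add_mem _ (boundedHits_le_hitSubspace _ _ _ hsub)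
        (mem_hitSubspace_of_mem_pointIdeal_pow hsub' (hgd.sub hg'd))
      rw [sub_add_sub_cancel] at h1
      rw [Submodule.mkQ_apply, (Submodule.Quotient.eq _).2 h1, ← Submodule.mkQ_apply]
      refine (Submodule.span_le (p := (LinearMap.range T).comap (hitSubspace F (K + 2)).mkQ)).2
        ?_ hg'
      rintro _ ⟨h, k, α, hh, hk, rfl⟩
      classical
      replace hk : Fintype.card F * A + (k + ∑ j, (α j : ℕ)) = d := hk
      have hα : k + ∑ j, (α j : ℕ) = δ := by omega
      let a : ι := ⟨α, by omega⟩
      have ha : μ a = reducedMonomial F k α := by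
        change reducedMonomial F (δ - ∑ j, (α j : ℕ)) α = _
        rw [← hα, Nat.add_sub_cancel]
      refine ⟨Pi.single a ⟨(hitSubspace F (K + 1)).mkQ h,
        Submodule.mem_map_of_mem ((mem_homogeneousSubmodule A h).2 hh)⟩, ?_⟩
      rw [hT, Finset.sum_eq_single a, Pi.single_eq_same, ht a h hh, ha]
      · intro b _ hb
        rw [Pi.single_eq_of_ne hb]
        exact map_zero _
      · exact fun h => absurd (Finset.mem_univ _) h
  rw [← hrange, LinearMap.finrank_range_of_inj hinj, Module.finrank_pi_fintype, Finset.sum_const,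
    Finset.card_univ, smul_eq_mul]
  congr 1
  exact card_sum_reduced_le K

/-- The base case: positive operations raise degrees, so no nonzero constant is hit. -/
theorem finrank_cohits_one_zero : Module.finrank F (cohits F 1 0) = 1 := by
  have h0 : ∀ f ∈ hitSubspace F 1, homogeneousComponent 0 f = 0 := by
    intro f hf
    refine (Submodule.span_le (p := LinearMap.ker (homogeneousComponent 0))).2 ?_ hf
    rintro _ ⟨k, hk, g, rfl⟩
    change homogeneousComponent 0 (reducedPower F k 1 g) = 0
    have : 0 < (Fintype.card F - 1) * k :=
      Nat.mul_pos (Nat.sub_pos_of_lt Fintype.one_lt_card) hk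
    rw [homogeneousComponent_reducedPower_apply, if_neg (by omega)]
  have h1 : (hitSubspace F 1).mkQ 1 ≠ 0 := by
    rw [Submodule.mkQ_apply, Ne, Submodule.Quotient.mk_eq_zero]
    intro h
    have := h0 1 h
    rw [homogeneousComponent_eq_self (isHomogeneous_one _ _)] at this
    exact one_ne_zero this
  have h2 : cohits F 1 0 = F ∙ (hitSubspace F 1).mkQ 1 := by
    rw [cohits, homogeneousSubmodule_zero, Submodule.one_eq_span, Submodule.map_span,
      Set.image_singleton]
  rw [h2, finrank_span_singleton h1]

theorem finrank_cohits_lowDegree (K : ℕ) :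
    Module.finrank F (cohits F (K + 1) (lowDegree F K)) =
      ∏ i ∈ Finset.Icc 1 K, (Fintype.card F ^ i - 1) := by
  induction K with
  | zero => exact finrank_cohits_one_zero
  | succ K ih => rw [finrank_cohits_succ, ih, Finset.prod_Icc_succ_top (by omega), mul_comm]

end Dimension

end HitProblem

end

theorem theorem1p3 (F : Type*) [Field F] [Fintype F] (n : ℕ) (hn : 2 ≤ n) :
    Module.finrank F
        (HitProblem.indecomposablesDegree F n (Fintype.card F ^ (n - 1) - n)) =
      ∏ i ∈ Finset.Icc 1 (n - 1), (Fintype.card F ^ i - 1) := by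
  obtain ⟨K, rfl⟩ : ∃ K, n = K + 1 := ⟨n - 1, by omega⟩
  rw [HitProblem.finrank_indecomposablesDegree, Nat.add_sub_cancel]
  exact HitProblem.finrank_cohits_lowDegree K
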